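/- Let $0<k<k'<n$ and let $\varkappa$ be an integer with $k\le\varkappa<n-k'$. For $1\le m<n$ let $G_{n,m}$ be the Grassmannian of $m$-dimensional linear subspaces of $\mathbb R^n$ with its $O(n)$-invariant probability measure, and let $G(n,m)$ be the affine Grassmannian of $m$-dimensional affine planes $\tau=\xi+u\equiv(\xi,u)$, $\xi\in G_{n,m}$, $u\in\xi^\perp$, with the measure $d\tau=d\xi\,du$ ($du$ the Euclidean volume on $\xi^\perp$) and $|\tau|=|u|$. For a linear subspace $h$ let $G_m(h)$ be the Grassmannian of $m$-dimensional subspaces of $h$ and $d_h$ its orthogonally invariant probability measure. For $f:G(n,k)\to\mathbb C$ and $m\in\{k',\,k'+\varkappa\}$ put $$(Rf)(\eta,v)=\int_{G_k(\eta)}d_\eta\xi\int_{\xi^\perp\cap\eta}f(\xi,v+x)\,dx,\qquad \eta\in G_{n,m},\ v\in\eta^\perp ;$$ this is denoted $Rf$ for $m=k'$ and $\tilde Rf$ for $m=k'+\varkappa$. For $h\in G_{n,k'+\varkappa}$, $\alpha\in h^\perp$ and $\xi\in G_k(h)$ put $$g_{h,\alpha}(\xi)=\int_{\xi^\perp\cap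 h}f(\xi,y+\alpha)\,dy .$$ (i) Let $f\in L^p(G(n,k))$, $1\le p<\frac{n-k}{k'-k+\varkappa}$. Then for almost every $\tilde\zeta=(h,\alpha)\in G(n,k'+\varkappa)$: $(\tilde R|f|)(\tilde\zeta)<\infty$; the integral $g_{h,\alpha}(\xi)$ converges absolutely for almost every $\xi\in G_k(h)$ and $g_{h,\alpha}\in L^1(G_k(h))$; and for almost every $\eta\in G_{k'}(h)$, $$\int_{G_k(\eta)}g_{h,\alpha}(\xi)\,d_\eta\xi=\int_\pi (Rf)(\eta,v)\,d_\pi v,\qquad \pi=(\eta^\perp\cap h)+\alpha,\tag{$*$}$$ where $d_\pi v$ is the Euclidean volume on the $\varkappa$-dimensional plane $\pi\subset\eta^\perp$ and all integrals exist in the Lebesgue sense. If $f$ is moreover Borel measurable, the last two assertions hold for every $\tilde\zeta=(h,\alpha)$ with $(\tilde R|f|)(\tilde\zeta)<\infty$. (ii) Let $f$ be continuous on $G(n,k)$ with $f(\tau)=O(|\tau|^{-\mu})$ as $|\tau|\to\infty$, where $\mu>k'-k+\varkappa$. Then for every $\tilde\zeta=(h,\alpha)\in G(n,k'+\varkappa)$: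 $(\tilde R|f|)(\tilde\zeta)<\infty$; $g_{h,\alpha}(\xi)$ converges absolutely for every $\xi\in G_k(h)$, and $g_{h,\alpha}$ is continuous (hence integrable) on $G_k(h)$; and $(*)$ holds, with all integrals existing in the Lebesgue sense, for every $\eta\in G_{k'}(h)$. -/

import Mathlib

open MeasureTheory Filter Topology
open scoped ENNReal

noncomputable section

namespace RadonGrassmann

variable {V : Type} [NormedAddCommGroup V] [InnerProductSpace ℝ V] [FiniteDimensional ℝ V]

/-! ### Lebesgue measure on a linear subspace -/

/-- The Euclidean volume of a linear subspace `W`, i.e. Lebesgue measure in any orthonormal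
coordinates of `W`. (The instance is given explicitly because `volume` on a subtype could also be
read as the restriction of the volume of the ambient space.) -/
def eucl [MeasurableSpace V] [BorelSpace V] (W : Submodule ℝ V) : Measure W :=
  (measureSpaceOfInnerProductSpace : MeasureSpace W).volume

/-! ### The compact Grassmannian -/

/-- The Grassmannian of `k`-dimensional linear subspaces of `V`.  For a subspace `h`, the
Grassmannian of `k`-dimensional subspaces of `h` is `Gr k h`. -/
@[ext]
structure Gr (k : ℕ) (V : Type) [NormedAddCommGroup V] [InnerProductSpace ℝ V] : Type where
  sub : Submodule ℝ V
  finrank_eq : Module.finrank ℝ sub = k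

/-- The usual topology of the Grassmannian: subspaces are identified with their orthogonal
projections. -/
instance (k : ℕ) : TopologicalSpace (Gr k V) :=
  TopologicalSpace.induced (fun W => W.sub.starProjection) inferInstance

instance (k : ℕ) : MeasurableSpace (Gr k V) := borel _

instance (k : ℕ) : BorelSpace (Gr k V) := ⟨rfl⟩

/-- A subspace of `h`, viewed as a subspace of the ambient space. -/
def Gr.incl {k : ℕ} {h : Submodule ℝ V} (ξ : Gr k h) : Gr k V :=
  ⟨ξ.sub.map h.subtype, by
    rw [(Submodule.equivMapOfInjective h.subtype h.injective_subtype ξ.sub).symm.finrank_eq]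
    exact ξ.finrank_eq⟩

/-- The orthogonal group of `V`. -/
abbrev Orth (V : Type) [NormedAddCommGroup V] [InnerProductSpace ℝ V] [CompleteSpace V] :=
  unitary (V →L[ℝ] V)

instance [CompleteSpace V] : CompactSpace (Orth V) := by
  have : ProperSpace (V →L[ℝ] V) := FiniteDimensional.proper ℝ _
  refine isCompact_iff_compactSpace.mp (Metric.isCompact_of_isClosed_isBounded ?_ ?_)
  · have h1 : Continuous fun T : V →L[ℝ] V => star T * T := by fun_prop
    have h2 : Continuous fun T : V →L[ℝ] V => T * star T := by fun_prop
    exact (isClosed_singleton.preimage h1).inter (isClosed_singleton.preimage h2)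
  · refine (Metric.isBounded_closedBall (x := (0 : V →L[ℝ] V)) (r := 1)).subset fun T hT => ?_
    rw [mem_closedBall_zero_iff]
    refine T.opNorm_le_bound zero_le_one fun x => ?_
    rw [one_mul, ContinuousLinearMap.norm_map_of_mem_unitary hT]

/-- The image `U W` of a subspace `W` under an orthogonal transformation `U`. -/
def Gr.rotate [CompleteSpace V] {k : ℕ} (U : Orth V) (W : Gr k V) : Gr k V :=
  ⟨W.sub.map (U.1 : V →ₗ[ℝ] V), by
    have hU : Function.Injective (U.1 : V →ₗ[ℝ] V) := fun x y hxy => by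
      have h := ContinuousLinearMap.norm_map_of_mem_unitary U.2 (x - y)
      rw [map_sub, sub_eq_zero.mpr (show U.1 x = U.1 y from hxy), norm_zero] at h
      exact sub_eq_zero.mp (norm_eq_zero.mp h.symm)
    rw [(Submodule.equivMapOfInjective _ hU W.sub).symm.finrank_eq]
    exact W.finrank_eq⟩

open Classical in
/-- The orthogonally invariant probability measure on the Grassmannian: the image of the normalized
Haar measure of the orthogonal group under `U ↦ U W₀`, for some (equivalently any) base point
`W₀`. -/
def Gr.measure (k : ℕ) (V : Type) [NormedAddCommGroup V] [InnerProductSpace ℝ V]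
    [FiniteDimensional ℝ V] [CompleteSpace V] : Measure (Gr k V) :=
  if hne : Nonempty (Gr k V) then
    (Measure.haarMeasure (⊤ : TopologicalSpace.PositiveCompacts (Orth V))).map
      (fun U => Gr.rotate U hne.some)
  else 0

/-- The Funk–Radon transform on the Grassmannians of `V`:
`g ↦ ∫_{ξ ⊂ η} g(ξ) d_η ξ`, `η` of dimension `k'`. -/
def funk {k k' : ℕ} (g : Gr k V → ℂ) (η : Gr k' V) : ℂ :=
  ∫ ξ : Gr k η.sub, g ξ.incl ∂(Gr.measure k η.sub)

/-! ### The affine Grassmannian -/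

/-- The affine Grassmannian of `k`-dimensional affine planes in `V`. -/
@[ext]
structure AffGr (k : ℕ) (V : Type) [NormedAddCommGroup V] [InnerProductSpace ℝ V] : Type where
  aff : AffineSubspace ℝ V
  nonempty : (aff : Set V).Nonempty
  finrank_eq : Module.finrank ℝ aff.direction = k

/-- The plane `ξ + u`. -/
def AffGr.of {k : ℕ} (ξ : Gr k V) (u : V) : AffGr k V :=
  ⟨AffineSubspace.mk' u ξ.sub, ⟨u, AffineSubspace.self_mem_mk' u ξ.sub⟩, by
    rw [AffineSubspace.direction_mk']; exact ξ.finrank_eq⟩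

/-- The linear subspace `ξ` parallel to `τ = ξ + u`. -/
def AffGr.dir {k : ℕ} (τ : AffGr k V) : Gr k V := ⟨τ.aff.direction, τ.finrank_eq⟩

/-- The unique point `u` of `τ` that is orthogonal to the direction of `τ`: the orthogonal
projection of the origin to `τ`. -/
def AffGr.foot {k : ℕ} (τ : AffGr k V) : V :=
  haveI : Nonempty τ.aff := τ.nonempty.to_subtype
  EuclideanGeometry.orthogonalProjection τ.aff 0

/-- The topology of the affine Grassmannian, from the parametrization of `τ` by its direction
`ξ` and the point `u ∈ ξᗮ` with `τ = ξ + u`. -/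
instance (k : ℕ) : TopologicalSpace (AffGr k V) :=
  TopologicalSpace.induced (fun τ => (τ.dir, τ.foot)) inferInstance

instance (k : ℕ) : MeasurableSpace (AffGr k V) := borel _

instance (k : ℕ) : BorelSpace (AffGr k V) := ⟨rfl⟩

/-- The distance of a plane to the origin. -/
def AffGr.dist0 {k : ℕ} (τ : AffGr k V) : ℝ := Metric.infDist 0 (τ.aff : Set V)

/-- The Euclidean volume `du` of `ξᗮ`, carried over to the planes `ξ + u`, `u ∈ ξᗮ`. -/
def AffGr.fibre {k : ℕ} [MeasurableSpace V] [BorelSpace V] (ξ : Gr k V) : Measure (AffGr k V) :=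
  (eucl ξ.subᗮ).map fun u : ↥ξ.subᗮ => AffGr.of ξ (u : V)

/-- The measure `dτ = dξ du` on the affine Grassmannian, where `τ = ξ + u`, `dξ` is the invariant
probability measure on the Grassmannian and `du` is the Euclidean volume of `ξᗮ`. -/
def AffGr.measure (k : ℕ) (V : Type) [NormedAddCommGroup V] [InnerProductSpace ℝ V]
    [FiniteDimensional ℝ V] [CompleteSpace V] [MeasurableSpace V] [BorelSpace V] :
    Measure (AffGr k V) :=
  (Gr.measure k V).bind AffGr.fibre

/-! ### The measures are what they should be

`Gr.measure` is an orthogonally invariant probability measure; `τ ↦ (dir τ, foot τ)` parametrizes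
the affine Grassmannian, `|τ|` is the norm of the foot point, and `ξ ↦ AffGr.fibre ξ` is measurable,
so that `AffGr.measure` is the iterated integral `dξ du`. -/

theorem Gr.starProjection_rotate [CompleteSpace V] {k : ℕ} (U : Orth V) (W : Gr k V) :
    (Gr.rotate U W).sub.starProjection = U.1 * W.sub.starProjection * star U.1 := by
  ext x
  exact Submodule.starProjection_map_apply (Unitary.linearIsometryEquiv U) W.sub x

theorem Gr.continuous_rotate [CompleteSpace V] {k : ℕ} (W : Gr k V) :
    Continuous fun U : Orth V => Gr.rotate U W := by
  refine continuous_induced_rng.mpr ?_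
  have : (fun W : Gr k V => W.sub.starProjection) ∘ (fun U : Orth V => Gr.rotate U W)
      = fun U : Orth V => U.1 * W.sub.starProjection * star U.1 := by
    funext U; exact Gr.starProjection_rotate U W
  rw [this]
  fun_prop

theorem Gr.isProbabilityMeasure [CompleteSpace V] {k : ℕ} (h : k ≤ Module.finrank ℝ V) :
    IsProbabilityMeasure (Gr.measure k V) := by
  have hne : Nonempty (Gr k V) := by
    obtain ⟨f, hf⟩ := exists_linearIndependent_of_le_finrank (R := ℝ) (M := V) h
    exact ⟨⟨Submodule.span ℝ (Set.range f), by simpa using finrank_span_eq_card hf⟩⟩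
  rw [Gr.measure, dif_pos hne]
  have : IsProbabilityMeasure
      (Measure.haarMeasure (⊤ : TopologicalSpace.PositiveCompacts (Orth V))) :=
    ⟨Measure.haarMeasure_self⟩
  exact Measure.isProbabilityMeasure_map (Gr.continuous_rotate _).measurable.aemeasurable

theorem Gr.rotate_mul [CompleteSpace V] {k : ℕ} (U U' : Orth V) (W : Gr k V) :
    Gr.rotate (U * U') W = Gr.rotate U (Gr.rotate U' W) := by
  apply Gr.ext
  exact (Submodule.map_comp _ _ _)

theorem Gr.continuous_rotate' [CompleteSpace V] {k : ℕ} (U : Orth V) :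
    Continuous fun W : Gr k V => Gr.rotate U W := by
  refine continuous_induced_rng.mpr ?_
  have : (fun W : Gr k V => W.sub.starProjection) ∘ (fun W => Gr.rotate U W)
      = fun W : Gr k V => U.1 * W.sub.starProjection * star U.1 := by
    funext W; exact Gr.starProjection_rotate U W
  rw [this]
  have : Continuous fun W : Gr k V => W.sub.starProjection := continuous_induced_dom
  fun_prop

theorem Gr.map_rotate_measure [CompleteSpace V] {k : ℕ} (U : Orth V) :
    (Gr.measure k V).map (Gr.rotate U) = Gr.measure k V := by
  rw [Gr.measure]
  split_ifs with hne
  · rw [Measure.map_map (Gr.continuous_rotate' U).measurable (Gr.continuous_rotate _).measurable]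
    conv_rhs => rw [← MeasureTheory.map_mul_left_eq_self
      (Measure.haarMeasure (⊤ : TopologicalSpace.PositiveCompacts (Orth V))) U]
    rw [Measure.map_map (Gr.continuous_rotate _).measurable (measurable_const_mul U)]
    congr 1
    funext U'
    exact (Gr.rotate_mul _ _ _).symm
  · simp

theorem Gr.exists_rotate [CompleteSpace V] {k : ℕ} (W W' : Gr k V) :
    ∃ U : Orth V, Gr.rotate U W = W' := by
  let e : W.sub ≃ₗᵢ[ℝ] W'.sub := (stdOrthonormalBasis ℝ W.sub).repr.trans
    (((stdOrthonormalBasis ℝ W'.sub).reindex (finCongr (W'.finrank_eq.trans W.finrank_eq.symm))).repr.symm)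
  let L : V →ₗᵢ[ℝ] V := (W'.sub.subtypeₗᵢ.comp e.toLinearIsometry).extend
  let E : V ≃ₗᵢ[ℝ] V := L.toLinearIsometryEquiv rfl
  refine ⟨Unitary.linearIsometryEquiv.symm E, Gr.ext ?_⟩
  ext x
  constructor
  · rintro ⟨y, hy, rfl⟩
    have : L y = (e ⟨y, hy⟩ : V) :=
      (W'.sub.subtypeₗᵢ.comp e.toLinearIsometry).extend_apply ⟨y, hy⟩
    exact (show L y ∈ W'.sub from this ▸ (e ⟨y, hy⟩).2)
  · intro hx
    refine ⟨e.symm ⟨x, hx⟩, (e.symm ⟨x, hx⟩).2, ?_⟩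
    have : L (e.symm ⟨x, hx⟩ : V) = (e (e.symm ⟨x, hx⟩) : V) :=
      (W'.sub.subtypeₗᵢ.comp e.toLinearIsometry).extend_apply (e.symm ⟨x, hx⟩)
    rw [e.apply_symm_apply] at this
    exact this

theorem AffGr.foot_of {k : ℕ} (ξ : Gr k V) (u : V) (hu : u ∈ ξ.subᗮ) :
    (AffGr.of ξ u).foot = u := by
  have : Nonempty (AffGr.of ξ u).aff := (AffGr.of ξ u).nonempty.to_subtype
  refine EuclideanGeometry.coe_orthogonalProjection_eq_iff_mem.mpr
    ⟨AffineSubspace.self_mem_mk' _ _, ?_⟩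
  simp only [AffGr.of, AffineSubspace.direction_mk']
  simpa using hu

theorem AffGr.dir_of {k : ℕ} (ξ : Gr k V) (u : V) : (AffGr.of ξ u).dir = ξ :=
  Gr.ext (AffineSubspace.direction_mk' _ _)

theorem AffGr.of_dir_foot {k : ℕ} (τ : AffGr k V) : AffGr.of τ.dir τ.foot = τ := by
  have : Nonempty τ.aff := τ.nonempty.to_subtype
  exact AffGr.ext (AffineSubspace.mk'_eq (EuclideanGeometry.orthogonalProjection_mem _))

theorem AffGr.dist0_eq {k : ℕ} (τ : AffGr k V) : τ.dist0 = ‖τ.foot‖ := by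
  have : Nonempty τ.aff := τ.nonempty.to_subtype
  have := EuclideanGeometry.dist_orthogonalProjection_eq_infDist τ.aff (0 : V)
  rw [dist_zero_left] at this
  exact this.symm

instance {k : ℕ} : T0Space (Gr k V) :=
  (Topology.IsEmbedding.mk ⟨rfl⟩ (fun W W' h => Gr.ext
    (by simpa using congrArg (fun T : V →L[ℝ] V => T.range) h)) :
      Topology.IsEmbedding fun W : Gr k V => W.sub.starProjection).t0Space

instance {k : ℕ} : SecondCountableTopology (Gr k V) :=
  (Topology.IsInducing.mk rfl :
      Topology.IsInducing fun W : Gr k V => W.sub.starProjection).secondCountableTopology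

theorem AffGr.continuous_of {k : ℕ} {X : Type*} [TopologicalSpace X] {a : X → Gr k V} {b : X → V}
    (ha : Continuous a) (hb : Continuous b) (hab : ∀ x, b x ∈ (a x).1ᗮ) :
    Continuous fun x => AffGr.of (a x) (b x) := by
  refine continuous_induced_rng.mpr ?_
  refine (ha.prodMk hb).congr fun x => ?_
  simp [AffGr.dir_of, AffGr.foot_of _ _ (hab x)]

theorem Gr.orthogonal_rotate [CompleteSpace V] {k : ℕ} (U : Orth V) (W : Gr k V) :
    (Gr.rotate U W).subᗮ = W.subᗮ.map ((Unitary.linearIsometryEquiv U).toLinearEquiv : V →ₗ[ℝ] V) := by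
  exact (Submodule.map_orthogonal_equiv W.sub (Unitary.linearIsometryEquiv U)).symm

theorem AffGr.fibre_rotate [CompleteSpace V] [MeasurableSpace V] [BorelSpace V] {k : ℕ} (U : Orth V)
    (W : Gr k V) : AffGr.fibre (Gr.rotate U W) =
      (eucl W.subᗮ).map fun u : ↥W.subᗮ => AffGr.of (Gr.rotate U W) (U.1 u) := by
  let f := (Unitary.linearIsometryEquiv U)
  have hp := Gr.orthogonal_rotate U W
  let e : ↥W.subᗮ ≃ₗᵢ[ℝ] ↥(Gr.rotate U W).subᗮ :=
    (f.submoduleMap W.subᗮ).trans (LinearIsometryEquiv.ofEq _ _ hp.symm)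
  have he : (eucl W.subᗮ).map e = eucl (Gr.rotate U W).subᗮ :=
    e.measurePreserving.map_eq
  rw [AffGr.fibre, ← he, Measure.map_map]
  · rfl
  · exact (AffGr.continuous_of continuous_const continuous_subtype_val fun x => x.2).measurable
  · exact e.continuous.measurable

theorem AffGr.measurable_fibre [CompleteSpace V] [MeasurableSpace V] [BorelSpace V] {k : ℕ} :
    Measurable (AffGr.fibre (k := k) (V := V)) := by
  rcases isEmpty_or_nonempty (Gr k V) with h | ⟨⟨W⟩⟩
  · exact measurable_of_empty _
  have hc : IsClosed (unitary (V →L[ℝ] V) : Set (V →L[ℝ] V)) :=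
    (isCompact_iff_compactSpace.mpr (inferInstance : CompactSpace (Orth V))).isClosed
  have : PolishSpace (Orth V) := hc.polishSpace
  have hs : Function.Surjective fun U : Orth V => Gr.rotate U W := fun W' => Gr.exists_rotate W W'
  rw [← (Gr.continuous_rotate W).measurable.measurable_comp_iff_of_surjective hs]
  have hF : Measurable fun p : Orth V × ↥W.subᗮ => AffGr.of (Gr.rotate p.1 W) (p.1.1 p.2) := by
    refine (AffGr.continuous_of ((Gr.continuous_rotate W).comp continuous_fst) ?_ ?_).measurable
    · have h1 : Continuous fun p : Orth V × ↥W.subᗮ => p.1.1 := by fun_prop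
      have h2 : Continuous fun p : Orth V × ↥W.subᗮ => (p.2 : V) := by fun_prop
      exact h1.clm_apply h2
    · intro p
      change _ ∈ (Gr.rotate p.1 W).subᗮ
      rw [Gr.orthogonal_rotate]
      exact ⟨p.2, p.2.2, rfl⟩
  refine Measure.measurable_of_measurable_coe _ fun s hs => ?_
  have : SFinite (eucl W.subᗮ) := by unfold eucl; infer_instance
  convert (measurable_measure_prodMk_left (ν := eucl W.subᗮ) (hF hs)) using 1
  funext U
  simp only [Function.comp, AffGr.fibre_rotate]
  exact Measure.map_apply (hF.comp measurable_prodMk_left) hs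

/-- The space `C_μ`: continuous functions with `f(τ) = O(|τ|^{-μ})` as `|τ| → ∞`. -/
def MemC {k : ℕ} (μ : ℝ) (f : AffGr k V → ℂ) : Prop :=
  Continuous f ∧ f =O[comap AffGr.dist0 atTop] fun τ => τ.dist0 ^ (-μ)

/-! ### Radon transforms -/

variable [MeasurableSpace V] [BorelSpace V]

/-- `(R f)(ζ) = ∫_{ξ ⊂ η} d_η ξ ∫_{ξᗮ ∩ η} f(ξ + (v + x)) dx`, where `ζ = η + v`, `v ∈ ηᗮ`: the
Radon transform from `k`-planes to `m`-planes. -/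
def radon {k m : ℕ} (f : AffGr k V → ℂ) (ζ : AffGr m V) : ℂ :=
  ∫ ξ : Gr k ζ.dir.sub,
    ∫ x : ↥(ξ.incl.subᗮ ⊓ ζ.dir.sub), f (AffGr.of ξ.incl (ζ.foot + x)) ∂(eucl _)
  ∂(Gr.measure k ζ.dir.sub)

/-- `(R |f|)(ζ)`, as an element of `[0, ∞]`. -/
def radonAbs {k m : ℕ} (f : AffGr k V → ℂ) (ζ : AffGr m V) : ℝ≥0∞ :=
  ∫⁻ ξ : Gr k ζ.dir.sub,
    ∫⁻ x : ↥(ξ.incl.subᗮ ⊓ ζ.dir.sub), ‖f (AffGr.of ξ.incl (ζ.foot + x))‖ₑ ∂(eucl _)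
  ∂(Gr.measure k ζ.dir.sub)

/-- `g_{h,α}(ξ) = ∫_{ξᗮ ∩ h} f(ξ + (y + α)) dy`, for `ξ ⊂ h`. -/
def sliceInt {k : ℕ} (f : AffGr k V → ℂ) (h : Submodule ℝ V) (α : V) (ξ : Gr k h) : ℂ :=
  ∫ y : ↥(ξ.incl.subᗮ ⊓ h), f (AffGr.of ξ.incl (y + α)) ∂(eucl _)

/-- The integral defining `g_{h,α}(ξ)` converges absolutely. -/
def SliceConverges {k : ℕ} (f : AffGr k V → ℂ) (h : Submodule ℝ V) (α : V) (ξ : Gr k h) : Prop :=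
  Integrable (fun y : ↥(ξ.incl.subᗮ ⊓ h) => f (AffGr.of ξ.incl (y + α))) (eucl _)

/-- The identity `∫_{ξ ⊂ η} g_{h,α}(ξ) d_η ξ = ∫_π (R f)(η, v) d_π v`, `π = (ηᗮ ∩ h) + α`, for a
`k'`-dimensional subspace `η` of `h`, with all integrals existing in the Lebesgue sense. The points
of `π` are written as `v = w + α`, `w ∈ ηᗮ ∩ h`. -/
def SliceIdentity {k k' : ℕ} (f : AffGr k V → ℂ) (h : Submodule ℝ V) (α : V) (η : Gr k' h) : Prop :=
  (∀ᵐ ξ ∂(Gr.measure k η.sub), SliceConverges f h α ξ.incl) ∧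
  Integrable (fun ξ : Gr k η.sub => sliceInt f h α ξ.incl) (Gr.measure k η.sub) ∧
  (∀ᵐ w : ↥(η.incl.subᗮ ⊓ h) ∂(eucl _), radonAbs f (AffGr.of η.incl ((w : V) + α)) < ∞) ∧
  Integrable (fun w : ↥(η.incl.subᗮ ⊓ h) => radon f (AffGr.of η.incl ((w : V) + α))) (eucl _) ∧
  funk (sliceInt f h α) η =
    ∫ w : ↥(η.incl.subᗮ ⊓ h), radon f (AffGr.of η.incl ((w : V) + α)) ∂(eucl _)

end RadonGrassmann

end

/-!
For a plane `ζ = h + α`, the iterated integrals in `R̃ f (ζ)` and on both sides of the slice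
identity are integrals of one function, `f` restricted to the `k`-planes contained in `ζ`, against
measures on the affine Grassmannian of `h`. On the planes of `ζ` whose direction lies in `η`, the
measure disintegrates either over the direction `ξ ⊂ η` or over the translates of `η` inside `ζ`,
so the identity is Fubini's theorem wherever `f` is integrable; and averaging these measures over
`η` gives the measure on all `k`-planes of `ζ`, so integrability for almost every `η` follows from
`R̃ |f| (ζ) < ∞`.

For `f ∈ L^p` that finiteness is proved by averaging over the planes `ζ` with `|ζ| ≤ R`. The
invariant measure of those containing `τ = ξ + u` is, up to a constant, the probability that a
random rotation of `ξᗮ` moves `u` into a tube of radius `R` around an `(m - k)`-plane, which is at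
most a multiple of `(1 + |u|) ^ (-(n - m))`. This weight is in the dual Lebesgue space exactly when
`p < (n - k) / (m - k)`. For `f` continuous and decaying, domination gives the integrability at
every plane.
-/

noncomputable section

namespace RadonGrassmann

variable {k m : ℕ}
variable {V : Type} [NormedAddCommGroup V] [InnerProductSpace ℝ V]
variable {V' : Type} [NormedAddCommGroup V'] [InnerProductSpace ℝ V']
variable {V'' : Type} [NormedAddCommGroup V''] [InnerProductSpace ℝ V'']

/-! ### Rotations and isometric images of planes -/

section Images

/-- The image of a linear subspace under a linear isometry. -/
def Gr.map (L : V →ₗᵢ[ℝ] V') (W : Gr k V) : Gr k V' :=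
  ⟨W.sub.map L.toLinearMap,
    (W.sub.equivMapOfInjective L.toLinearMap L.injective).finrank_eq.symm.trans W.finrank_eq⟩

theorem Gr.map_map (L' : V' →ₗᵢ[ℝ] V'') (L : V →ₗᵢ[ℝ] V') (W : Gr k V) :
    (W.map L).map L' = W.map (L'.comp L) :=
  Gr.ext (Submodule.map_comp _ _ _).symm

theorem Gr.map_mem_orthogonal {L : V →ₗᵢ[ℝ] V'} {W : Gr k V} {u : V} (hu : u ∈ W.subᗮ) :
    L u ∈ (W.map L).subᗮ := by
  rintro _ ⟨w, hw, rfl⟩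
  exact (L.inner_map_map w u).trans (hu w hw)

theorem Gr.orthogonal_range_le (L : V →ₗᵢ[ℝ] V') (W : Gr k V) :
    L.rangeᗮ ≤ (W.map L).subᗮ :=
  Submodule.orthogonal_le LinearMap.map_le_range

theorem AffGr.of_eq_of {ξ : Gr k V} {u u' : V} (h : u - u' ∈ ξ.sub) :
    AffGr.of ξ u = AffGr.of ξ u' :=
  AffGr.ext <| AffineSubspace.ext_of_direction_eq
    ((AffineSubspace.direction_mk' _ _).trans (AffineSubspace.direction_mk' _ _).symm)
    ⟨u, AffineSubspace.self_mem_mk' _ _, AffineSubspace.mem_mk'.mpr h⟩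

theorem range_subtypeₗᵢ (h : Submodule ℝ V) : h.subtypeₗᵢ.range = h :=
  h.range_subtype

theorem Gr.nonempty_of_le (h : k ≤ Module.finrank ℝ V) : Nonempty (Gr k V) := by
  obtain ⟨v, hv⟩ := exists_linearIndependent_of_le_finrank (R := ℝ) (M := V) h
  exact ⟨⟨Submodule.span ℝ (Set.range v), by simpa using finrank_span_eq_card hv⟩⟩

theorem Gr.le_finrank [FiniteDimensional ℝ V] (W : Gr k V) : k ≤ Module.finrank ℝ V :=
  W.finrank_eq ▸ Submodule.finrank_le W.sub

end Images

section Grassmannian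

variable [FiniteDimensional ℝ V] [FiniteDimensional ℝ V']

theorem Gr.isEmbedding_starProjection :
    IsEmbedding fun W : Gr k V => W.sub.starProjection :=
  ⟨⟨rfl⟩, fun _ _ h => Gr.ext (by simpa using congrArg (fun T : V →L[ℝ] V => T.range) h)⟩

instance : T2Space (Gr k V) := Gr.isEmbedding_starProjection.t2Space

theorem Gr.starProjection_map [CompleteSpace V] [CompleteSpace V'] (L : V →ₗᵢ[ℝ] V') (W : Gr k V) :
    (W.map L).sub.starProjection =
      L.toContinuousLinearMap ∘L W.sub.starProjection ∘L L.toContinuousLinearMap.adjoint := by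
  ext x
  refine Submodule.eq_starProjection_of_mem_of_inner_eq_zero
    ⟨_, Submodule.starProjection_apply_mem _ _, rfl⟩ ?_
  rintro _ ⟨w, hw, rfl⟩
  have hx : inner ℝ x (L w) = inner ℝ (L.toContinuousLinearMap.adjoint x) w :=
    (L.toContinuousLinearMap.adjoint_inner_left w x).symm
  have hort := W.sub.starProjection_inner_eq_zero (L.toContinuousLinearMap.adjoint x) w hw
  rw [inner_sub_left] at hort ⊢
  refine Eq.trans ?_ hort
  change inner ℝ x (L w) - inner ℝ (L _) (L w) = _
  rw [hx, L.inner_map_map]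
  rfl

theorem Gr.continuous_map (L : V →ₗᵢ[ℝ] V') : Continuous (Gr.map (k := k) L) := by
  refine Gr.isEmbedding_starProjection.continuous_iff.mpr ?_
  have hcomp := (L.toContinuousLinearMap.postcomp V').continuous.comp <|
    (L.toContinuousLinearMap.adjoint.precomp V).continuous.comp
      (Gr.isEmbedding_starProjection (k := k)).continuous
  exact hcomp.congr fun W => (Gr.starProjection_map L W).symm

theorem Gr.continuous_rotate_uncurry :
    Continuous fun p : Orth V × Gr k V => Gr.rotate p.1 p.2 := by
  refine Gr.isEmbedding_starProjection.continuous_iff.mpr ?_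
  have hU : Continuous fun p : Orth V × Gr k V => p.1.1 := by fun_prop
  have hmul : Continuous fun p : Orth V × Gr k V => p.1.1 * p.2.sub.starProjection * star p.1.1 :=
    (hU.mul (Gr.isEmbedding_starProjection.continuous.comp continuous_snd)).mul hU.star
  exact hmul.congr fun p => (Gr.starProjection_rotate p.1 p.2).symm

instance : PolishSpace (Orth V) :=
  (isCompact_iff_compactSpace.mpr (inferInstance : CompactSpace (Orth V))).isClosed.polishSpace

theorem Gr.measurable_of_comp_rotate {β : Type*} [MeasurableSpace β] (W : Gr k V) {g : Gr k V → β}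
    (hg : Measurable fun U : Orth V => g (Gr.rotate U W)) : Measurable g :=
  ((Gr.continuous_rotate W).measurable.measurable_comp_iff_of_surjective
    (Gr.exists_rotate W)).mp hg

theorem Gr.isQuotientMap_rotate (W : Gr k V) :
    IsQuotientMap fun U : Orth V => Gr.rotate U W :=
  (Gr.continuous_rotate W).isClosedMap.isQuotientMap (Gr.continuous_rotate W) (Gr.exists_rotate W)

instance : CompactSpace (Gr k V) := by
  rcases isEmpty_or_nonempty (Gr k V) with h | ⟨⟨W⟩⟩
  · exact Finite.compactSpace
  · exact ⟨Set.image_univ_of_surjective (Gr.exists_rotate W) ▸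
      isCompact_univ.image (Gr.continuous_rotate W)⟩

end Grassmannian

section InvariantMeasure

theorem isMulRightInvariant_haarMeasure_top {G : Type*} [Group G] [TopologicalSpace G]
    [IsTopologicalGroup G] [CompactSpace G] [MeasurableSpace G] [BorelSpace G] :
    (Measure.haarMeasure (⊤ : TopologicalSpace.PositiveCompacts G)).IsMulRightInvariant := by
  have : IsProbabilityMeasure (Measure.haarMeasure (⊤ : TopologicalSpace.PositiveCompacts G)) :=
    ⟨Measure.haarMeasure_self⟩
  refine ⟨fun g => ?_⟩
  have : IsProbabilityMeasure
      ((Measure.haarMeasure (⊤ : TopologicalSpace.PositiveCompacts G)).map (· * g)) :=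
    Measure.isProbabilityMeasure_map (measurable_mul_const g).aemeasurable
  exact Measure.isHaarMeasure_eq_of_isProbabilityMeasure _ _

/-- The normalized Haar measure of the orthogonal group of `V`. -/
abbrev orthHaar (V : Type) [NormedAddCommGroup V] [InnerProductSpace ℝ V] [FiniteDimensional ℝ V] :
    Measure (Orth V) :=
  Measure.haarMeasure (⊤ : TopologicalSpace.PositiveCompacts (Orth V))

variable [FiniteDimensional ℝ V]

instance : IsProbabilityMeasure (orthHaar V) := ⟨Measure.haarMeasure_self⟩

instance : (orthHaar V).IsMulRightInvariant := isMulRightInvariant_haarMeasure_top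

theorem Gr.measure_eq_map (W : Gr k V) :
    Gr.measure k V = (orthHaar V).map fun U => Gr.rotate U W := by
  have hne : Nonempty (Gr k V) := ⟨W⟩
  obtain ⟨U₀, hU₀⟩ := Gr.exists_rotate W hne.some
  rw [Gr.measure, dif_pos hne]
  conv_rhs => rw [← map_mul_right_eq_self (orthHaar V) U₀]
  rw [Measure.map_map (Gr.continuous_rotate _).measurable (measurable_mul_const U₀)]
  congr 1
  funext U
  simp only [Function.comp, Gr.rotate_mul, hU₀]

instance : IsFiniteMeasure (Gr.measure k V) := by
  rcases isEmpty_or_nonempty (Gr k V) with h | ⟨⟨W⟩⟩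
  · rw [Measure.eq_zero_of_isEmpty (Gr.measure k V)]
    infer_instance
  · rw [Gr.measure_eq_map W]
    infer_instance

theorem Gr.lintegral_measure (W : Gr k V) {φ : Gr k V → ℝ≥0∞} (hφ : Measurable φ) :
    ∫⁻ ξ, φ ξ ∂Gr.measure k V = ∫⁻ U, φ (Gr.rotate U W) ∂orthHaar V := by
  rw [Gr.measure_eq_map W, lintegral_map hφ (Gr.continuous_rotate W).measurable]

theorem Gr.eq_measure_of_map_rotate (ν : Measure (Gr k V)) [IsProbabilityMeasure ν]
    (hν : ∀ U : Orth V, ν.map (Gr.rotate U) = ν) : ν = Gr.measure k V := by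
  refine Measure.ext_of_lintegral _ fun φ hφ => ?_
  have hm : Measurable fun p : Orth V × Gr k V => φ (Gr.rotate p.1 p.2) :=
    hφ.comp Gr.continuous_rotate_uncurry.measurable
  calc ∫⁻ ξ, φ ξ ∂ν = ∫⁻ _ : Orth V, ∫⁻ ξ, φ ξ ∂ν ∂orthHaar V := by simp
    _ = ∫⁻ U : Orth V, ∫⁻ ξ, φ (Gr.rotate U ξ) ∂ν ∂orthHaar V := by
      refine lintegral_congr fun U => ?_
      conv_lhs => rw [← hν U]
      rw [lintegral_map hφ (Gr.continuous_rotate' U).measurable]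
    _ = ∫⁻ ξ, ∫⁻ U : Orth V, φ (Gr.rotate U ξ) ∂orthHaar V ∂ν :=
      lintegral_lintegral_swap hm.aemeasurable
    _ = ∫⁻ _, ∫⁻ ξ, φ ξ ∂Gr.measure k V ∂ν :=
      lintegral_congr fun ξ => (Gr.lintegral_measure ξ hφ).symm
    _ = ∫⁻ ξ, φ ξ ∂Gr.measure k V := by simp

theorem Gr.map_measure [FiniteDimensional ℝ V'] (e : V ≃ₗᵢ[ℝ] V') :
    (Gr.measure k V).map (Gr.map e.toLinearIsometry) = Gr.measure k V' := by
  have hm := (Gr.continuous_map (k := k) e.toLinearIsometry).measurable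
  rcases isEmpty_or_nonempty (Gr k V) with hV | ⟨⟨W⟩⟩
  · have : IsEmpty (Gr k V') := ⟨fun W => hV.elim (W.map e.symm.toLinearIsometry)⟩
    rw [Measure.eq_zero_of_isEmpty (Gr.measure k V), Measure.map_zero,
      Measure.eq_zero_of_isEmpty (Gr.measure k V')]
  have := Gr.isProbabilityMeasure W.le_finrank
  have : IsProbabilityMeasure ((Gr.measure k V).map (Gr.map e.toLinearIsometry)) :=
    Measure.isProbabilityMeasure_map hm.aemeasurable
  refine Gr.eq_measure_of_map_rotate _ fun U => ?_
  let U₀ : Orth V := Unitary.linearIsometryEquiv.symm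
    ((e.trans (Unitary.linearIsometryEquiv U)).trans e.symm)
  have hconj : Gr.rotate U ∘ Gr.map e.toLinearIsometry =
      Gr.map e.toLinearIsometry ∘ Gr.rotate (k := k) U₀ := by
    funext ξ
    change (ξ.map e.toLinearIsometry).map (Unitary.linearIsometryEquiv U).toLinearIsometry =
      (ξ.map (Unitary.linearIsometryEquiv U₀).toLinearIsometry).map e.toLinearIsometry
    rw [Gr.map_map, Gr.map_map]
    congr 1
    ext x
    simp [U₀]
  conv_rhs => rw [← Gr.map_rotate_measure U₀]
  rw [Measure.map_map (Gr.continuous_rotate' U).measurable hm,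
    Measure.map_map hm (Gr.continuous_rotate' U₀).measurable, hconj]

end InvariantMeasure

section AffineImages

variable [FiniteDimensional ℝ V]

theorem AffGr.foot_mem (τ : AffGr k V) : τ.foot ∈ τ.dir.subᗮ := by
  have : Nonempty τ.aff := τ.nonempty.to_subtype
  have h := (EuclideanGeometry.coe_orthogonalProjection_eq_iff_mem (s := τ.aff) (p := (0 : V))
    (q := τ.foot)).mp rfl
  rw [vsub_eq_sub, zero_sub, neg_mem_iff] at h
  exact h.2

theorem AffGr.foot_of_sub_mem (ξ : Gr k V) (u : V) : (AffGr.of ξ u).foot - u ∈ ξ.sub := by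
  have : Nonempty (AffGr.of ξ u).aff := (AffGr.of ξ u).nonempty.to_subtype
  exact AffineSubspace.mem_mk'.mp
    (EuclideanGeometry.orthogonalProjection_mem (s := (AffGr.of ξ u).aff) (0 : V))

theorem AffGr.isEmbedding_dir_foot : IsEmbedding fun τ : AffGr k V => (τ.dir, τ.foot) :=
  ⟨⟨rfl⟩, fun τ τ' h => by
    rw [← AffGr.of_dir_foot τ, ← AffGr.of_dir_foot τ', (Prod.mk.inj h).1, (Prod.mk.inj h).2]⟩

instance : T0Space (AffGr k V) := AffGr.isEmbedding_dir_foot.t0Space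

instance : SecondCountableTopology (AffGr k V) :=
  AffGr.isEmbedding_dir_foot.secondCountableTopology

theorem AffGr.continuous_dir : Continuous (AffGr.dir : AffGr k V → Gr k V) :=
  continuous_fst.comp AffGr.isEmbedding_dir_foot.continuous

theorem AffGr.continuous_foot : Continuous (AffGr.foot : AffGr k V → V) :=
  continuous_snd.comp AffGr.isEmbedding_dir_foot.continuous

/-- The image of an affine plane under the isometry `x ↦ L x + v`. -/
def AffGr.emb (L : V →ₗᵢ[ℝ] V') (v : V') (τ : AffGr k V) : AffGr k V' :=
  AffGr.of (τ.dir.map L) (L τ.foot + v)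

theorem AffGr.emb_of (L : V →ₗᵢ[ℝ] V') (v : V') (ξ : Gr k V) (u : V) :
    AffGr.emb L v (AffGr.of ξ u) = AffGr.of (ξ.map L) (L u + v) := by
  rw [AffGr.emb, AffGr.dir_of]
  apply AffGr.of_eq_of
  rw [add_sub_add_right_eq_sub, ← map_sub]
  exact ⟨_, AffGr.foot_of_sub_mem ξ u, rfl⟩

theorem AffGr.map_foot_add_mem_orthogonal (L : V →ₗᵢ[ℝ] V') {v : V'} (hv : v ∈ L.rangeᗮ)
    (τ : AffGr k V) : L τ.foot + v ∈ (τ.dir.map L).subᗮ :=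
  Submodule.add_mem _ (Gr.map_mem_orthogonal τ.foot_mem) (Gr.orthogonal_range_le L _ hv)

variable [FiniteDimensional ℝ V']

theorem AffGr.emb_emb (L' : V' →ₗᵢ[ℝ] V'') (v' : V'') (L : V →ₗᵢ[ℝ] V') (v : V')
    (τ : AffGr k V) : AffGr.emb L' v' (AffGr.emb L v τ) = AffGr.emb (L'.comp L) (L' v + v') τ := by
  rw [AffGr.emb.eq_1 L v, AffGr.emb_of, Gr.map_map, AffGr.emb]
  simp only [map_add, LinearIsometry.coe_comp, Function.comp, add_assoc]

theorem AffGr.dir_emb (L : V →ₗᵢ[ℝ] V') (v : V') (τ : AffGr k V) :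
    (AffGr.emb L v τ).dir = τ.dir.map L := AffGr.dir_of _ _

theorem AffGr.foot_emb (L : V →ₗᵢ[ℝ] V') {v : V'} (hv : v ∈ L.rangeᗮ) (τ : AffGr k V) :
    (AffGr.emb L v τ).foot = L τ.foot + v :=
  AffGr.foot_of _ _ (AffGr.map_foot_add_mem_orthogonal L hv τ)

theorem AffGr.continuous_emb_uncurry (L : V →ₗᵢ[ℝ] V') {X : Type*} [TopologicalSpace X]
    {a : X → AffGr k V} {b : X → V'} (ha : Continuous a) (hb : Continuous b)
    (hab : ∀ x, b x ∈ L.rangeᗮ) : Continuous fun x => AffGr.emb L (b x) (a x) :=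
  AffGr.continuous_of ((Gr.continuous_map L).comp (AffGr.continuous_dir.comp ha))
    ((L.continuous.comp (AffGr.continuous_foot.comp ha)).add hb)
    fun x => AffGr.map_foot_add_mem_orthogonal L (hab x) (a x)

theorem AffGr.continuous_emb (L : V →ₗᵢ[ℝ] V') {v : V'} (hv : v ∈ L.rangeᗮ) :
    Continuous (AffGr.emb (k := k) L v) :=
  AffGr.continuous_emb_uncurry L continuous_id continuous_const fun _ => hv

end AffineImages

section Subspace

variable [FiniteDimensional ℝ V]

theorem AffGr.continuous_emb_subtype_uncurry (h : Submodule ℝ V) :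
    Continuous fun p : AffGr k h × hᗮ => AffGr.emb h.subtypeₗᵢ (p.2 : V) p.1 :=
  AffGr.continuous_emb_uncurry _ continuous_fst (continuous_subtype_val.comp continuous_snd)
    fun p => by rw [range_subtypeₗᵢ]; exact p.2.2

theorem AffGr.continuous_emb_subtype {h : Submodule ℝ V} {v : V} (hv : v ∈ hᗮ) :
    Continuous (AffGr.emb (k := k) h.subtypeₗᵢ v) :=
  AffGr.continuous_emb _ (by rwa [range_subtypeₗᵢ])

end Subspace

section AffineRotations

variable [FiniteDimensional ℝ V]

/-- The image of an affine plane under an orthogonal transformation. -/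
def AffGr.rotate (U : Orth V) (τ : AffGr k V) : AffGr k V :=
  AffGr.emb (Unitary.linearIsometryEquiv U).toLinearIsometry 0 τ

theorem AffGr.rotate_of (U : Orth V) (ξ : Gr k V) (u : V) :
    AffGr.rotate U (AffGr.of ξ u) = AffGr.of (Gr.rotate U ξ) (U.1 u) := by
  rw [AffGr.rotate, AffGr.emb_of, add_zero]; rfl

theorem AffGr.dir_rotate (U : Orth V) (τ : AffGr k V) :
    (AffGr.rotate U τ).dir = Gr.rotate U τ.dir := AffGr.dir_emb _ _ _

theorem AffGr.foot_rotate (U : Orth V) (τ : AffGr k V) :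
    (AffGr.rotate U τ).foot = U.1 τ.foot := by
  rw [AffGr.rotate, AffGr.foot_emb _ (Submodule.zero_mem _), add_zero]; rfl

theorem AffGr.rotate_mul (U U' : Orth V) (τ : AffGr k V) :
    AffGr.rotate (U * U') τ = AffGr.rotate U (AffGr.rotate U' τ) := by
  rw [← AffGr.of_dir_foot τ, AffGr.rotate_of, AffGr.rotate_of, AffGr.rotate_of, Gr.rotate_mul]
  rfl

theorem AffGr.continuous_rotate_uncurry :
    Continuous fun p : Orth V × AffGr k V => AffGr.rotate p.1 p.2 := by
  rw [AffGr.isEmbedding_dir_foot.continuous_iff]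
  have hU : Continuous fun p : Orth V × AffGr k V => p.1.1 := by fun_prop
  have hdir : Continuous fun p : Orth V × AffGr k V => Gr.rotate p.1 p.2.dir :=
    Gr.continuous_rotate_uncurry.comp
      (continuous_fst.prodMk (AffGr.continuous_dir.comp continuous_snd))
  exact (hdir.prodMk (hU.clm_apply (AffGr.continuous_foot.comp continuous_snd))).congr
    fun p => (Prod.ext (AffGr.dir_rotate _ _) (AffGr.foot_rotate _ _)).symm

theorem AffGr.continuous_rotate (U : Orth V) : Continuous (AffGr.rotate (k := k) U) :=
  AffGr.continuous_emb _ (Submodule.zero_mem _)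

theorem AffGr.exists_rotate (W : Gr k V) (τ : AffGr k V) :
    ∃ (U : Orth V) (u : W.subᗮ), AffGr.rotate U (AffGr.of W u) = τ := by
  obtain ⟨U, hU⟩ := Gr.exists_rotate W τ.dir
  have hfoot := τ.foot_mem
  rw [← hU, Gr.orthogonal_rotate] at hfoot
  obtain ⟨u, hu, hUu : U.1 u = τ.foot⟩ := hfoot
  exact ⟨U, ⟨u, hu⟩, by rw [AffGr.rotate_of, hU, hUu, AffGr.of_dir_foot]⟩

end AffineRotations

/-! ### Measures on the affine Grassmannian -/

section OrthogonalComplements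

/-- The isometry between orthogonal complements induced by an isometry. -/
def Gr.orthogonalEquiv (e : V ≃ₗᵢ[ℝ] V') (ξ : Gr k V) :
    ξ.subᗮ ≃ₗᵢ[ℝ] (ξ.map e.toLinearIsometry).subᗮ :=
  (e.submoduleMap ξ.subᗮ).trans (LinearIsometryEquiv.ofEq _ _
    (Submodule.map_orthogonal_equiv ξ.sub e))

theorem Gr.coe_mem_orthogonal_incl {h : Submodule ℝ V} {ξ : Gr k h} {u : h} (hu : u ∈ ξ.subᗮ) :
    (u : V) ∈ ξ.incl.subᗮ :=
  Gr.map_mem_orthogonal (L := h.subtypeₗᵢ) hu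

theorem Gr.orthogonal_le_orthogonal_incl {h : Submodule ℝ V} (ξ : Gr k h) : hᗮ ≤ ξ.incl.subᗮ :=
  Submodule.orthogonal_le (Submodule.map_subtype_le h _)

theorem norm_coe_add_coe_orthogonal (h : Submodule ℝ V) (W : Submodule ℝ h)
    (p : WithLp 2 (W × hᗮ)) : ‖((p.fst : h) : V) + (p.snd : V)‖ = ‖p‖ := by
  have hort : inner ℝ ((p.fst : h) : V) (p.snd : V) = 0 := p.snd.2 _ (p.fst : h).2
  rw [← sq_eq_sq₀ (norm_nonneg _) (norm_nonneg _), WithLp.prod_norm_sq_eq_of_L2, sq,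
    norm_add_sq_eq_norm_sq_add_norm_sq_real hort, ← sq, ← sq]
  rfl

variable [FiniteDimensional ℝ V]

theorem Gr.orthogonalProjectionOnto_mem_orthogonal {h : Submodule ℝ V} {ξ : Gr k h} {y : V}
    (hy : y ∈ ξ.incl.subᗮ) : h.orthogonalProjectionOnto y ∈ ξ.subᗮ := by
  intro w hw
  rw [Submodule.inner_orthogonalProjectionOnto_eq_of_mem_left]
  exact hy _ ⟨w, hw, rfl⟩

/-- The orthogonal complement of `ξ ⊆ h` in the whole space is the orthogonal sum of its complement
in `h` and of `hᗮ`. -/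
def Gr.orthogonalSum (h : Submodule ℝ V) (ξ : Gr k h) :
    WithLp 2 (ξ.subᗮ × hᗮ) ≃ₗᵢ[ℝ] ξ.incl.subᗮ :=
  LinearIsometryEquiv.ofSurjective
    { toFun := fun p => ⟨((p.fst : h) : V) + (p.snd : V), Submodule.add_mem _
        (Gr.coe_mem_orthogonal_incl p.fst.2) (Gr.orthogonal_le_orthogonal_incl ξ p.snd.2)⟩
      map_add' := fun p q => by ext; simp; abel
      map_smul' := fun c p => by ext; simp
      norm_map' := norm_coe_add_coe_orthogonal h ξ.subᗮ }
    fun ⟨y, hy⟩ => ⟨WithLp.toLp 2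
      (⟨_, Gr.orthogonalProjectionOnto_mem_orthogonal hy⟩,
        ⟨_, Submodule.sub_starProjection_mem_orthogonal y⟩),
      Subtype.ext (add_sub_cancel (h.starProjection y) y)⟩

end OrthogonalComplements

section EuclideanVolume

variable [FiniteDimensional ℝ V] [MeasurableSpace V] [BorelSpace V]
variable [FiniteDimensional ℝ V'] [MeasurableSpace V'] [BorelSpace V']
variable [FiniteDimensional ℝ V''] [MeasurableSpace V''] [BorelSpace V'']

instance (W : Submodule ℝ V) : (eucl W).IsAddHaarMeasure := by
  unfold eucl; infer_instance

theorem map_eucl {W : Submodule ℝ V} {W' : Submodule ℝ V'} (e : W ≃ₗᵢ[ℝ] W') :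
    (eucl W).map e = eucl W' :=
  e.measurePreserving.map_eq

theorem map_eucl_prod {A : Submodule ℝ V} {B : Submodule ℝ V'} {C : Submodule ℝ V''}
    (e : WithLp 2 (A × B) ≃ₗᵢ[ℝ] C) :
    ((eucl A).prod (eucl B)).map (fun p => e (WithLp.toLp 2 p)) = eucl C := by
  let _ : MeasureSpace A := measureSpaceOfInnerProductSpace
  let _ : MeasureSpace B := measureSpaceOfInnerProductSpace
  let _ : MeasureSpace C := measureSpaceOfInnerProductSpace
  exact (e.measurePreserving.comp (WithLp.volume_preserving_toLp A B)).map_eq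

end EuclideanVolume

section Fibres

variable [FiniteDimensional ℝ V]

theorem AffGr.range_of (ξ : Gr k V) :
    Set.range (fun u : ξ.subᗮ => AffGr.of ξ (u : V)) = AffGr.dir ⁻¹' {ξ} := by
  ext τ
  constructor
  · rintro ⟨u, rfl⟩
    exact AffGr.dir_of _ _
  · rintro rfl
    exact ⟨⟨τ.foot, τ.foot_mem⟩, AffGr.of_dir_foot τ⟩

theorem AffGr.isClosedEmbedding_of (ξ : Gr k V) :
    IsClosedEmbedding fun u : ξ.subᗮ => AffGr.of ξ (u : V) := by
  have hleft : Function.LeftInverse (fun τ : AffGr k V => ξ.subᗮ.orthogonalProjectionOnto τ.foot)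
      fun u : ξ.subᗮ => AffGr.of ξ (u : V) := fun u => by
    simp [AffGr.foot_of ξ u u.2]
  refine ⟨.of_leftInverse hleft ((ContinuousLinearMap.continuous _).comp AffGr.continuous_foot)
    (AffGr.continuous_of continuous_const continuous_subtype_val fun u => u.2), ?_⟩
  rw [AffGr.range_of]
  exact isClosed_singleton.preimage AffGr.continuous_dir

variable [MeasurableSpace V] [BorelSpace V]

theorem AffGr.measurableEmbedding_of (ξ : Gr k V) :
    MeasurableEmbedding fun u : ξ.subᗮ => AffGr.of ξ (u : V) :=
  (AffGr.isClosedEmbedding_of ξ).measurableEmbedding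

instance (ξ : Gr k V) : SFinite (AffGr.fibre ξ) := by
  unfold AffGr.fibre; infer_instance

theorem AffGr.lintegral_fibre (ξ : Gr k V) (φ : AffGr k V → ℝ≥0∞) :
    ∫⁻ τ, φ τ ∂AffGr.fibre ξ = ∫⁻ u : ξ.subᗮ, φ (AffGr.of ξ (u : V)) ∂eucl ξ.subᗮ :=
  (AffGr.measurableEmbedding_of ξ).lintegral_map _

variable [FiniteDimensional ℝ V'] [MeasurableSpace V'] [BorelSpace V']

theorem AffGr.map_emb_fibre (e : V ≃ₗᵢ[ℝ] V') (ξ : Gr k V) :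
    (AffGr.fibre ξ).map (AffGr.emb e.toLinearIsometry 0) =
      AffGr.fibre (ξ.map e.toLinearIsometry) := by
  rw [AffGr.fibre, AffGr.fibre, ← map_eucl (Gr.orthogonalEquiv e ξ),
    Measure.map_map (AffGr.continuous_emb _ (Submodule.zero_mem _)).measurable
      (measurableEmbedding_of ξ).measurable,
    Measure.map_map (measurableEmbedding_of _).measurable
      (Gr.orthogonalEquiv e ξ).continuous.measurable]
  congr 1
  funext u
  simp only [Function.comp, AffGr.emb_of, add_zero]
  rfl

theorem AffGr.map_rotate_fibre (U : Orth V) (ξ : Gr k V) :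
    (AffGr.fibre ξ).map (AffGr.rotate U) = AffGr.fibre (Gr.rotate U ξ) :=
  AffGr.map_emb_fibre _ ξ

theorem AffGr.fibre_incl (h : Submodule ℝ V) (ξ : Gr k h) :
    AffGr.fibre ξ.incl =
      ((AffGr.fibre ξ).prod (eucl hᗮ)).map fun p => AffGr.emb h.subtypeₗᵢ (p.2 : V) p.1 := by
  have hemb := (AffGr.continuous_emb_subtype_uncurry (k := k) h).measurable
  have hsum : Measurable fun p : ξ.subᗮ × hᗮ => Gr.orthogonalSum h ξ (WithLp.toLp 2 p) :=
    ((Gr.orthogonalSum h ξ).continuous.comp (WithLp.prod_continuous_toLp 2 _ _)).measurable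
  have hprod : (AffGr.fibre ξ).prod (eucl hᗮ) = ((eucl ξ.subᗮ).prod (eucl hᗮ)).map
      (Prod.map (fun u : ξ.subᗮ => AffGr.of ξ (u : h)) id) := by
    rw [← Measure.map_prod_map _ _ (measurableEmbedding_of ξ).measurable measurable_id,
      Measure.map_id]
    rfl
  rw [hprod, Measure.map_map hemb ((measurableEmbedding_of ξ).measurable.prodMap measurable_id),
    AffGr.fibre, ← map_eucl_prod (Gr.orthogonalSum h ξ),
    Measure.map_map (measurableEmbedding_of _).measurable hsum]
  congr 1
  funext p
  simp only [Function.comp, Prod.map, AffGr.emb_of, id]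
  rfl

end Fibres

section Mixtures

variable {α β γ : Type*} [MeasurableSpace α] [MeasurableSpace β] [MeasurableSpace γ]

theorem map_bind {μ : Measure α} {ν : α → Measure β} {g : β → γ} (hν : Measurable ν)
    (hg : Measurable g) : (μ.bind ν).map g = μ.bind fun a => (ν a).map g := by
  rw [Measure.bind, Measure.bind, ← Measure.join_map_map hg,
    Measure.map_map (Measure.measurable_map g hg) hν]
  rfl

theorem bind_map {μ : Measure α} {g : α → β} {ν : β → Measure γ} (hg : Measurable g)
    (hν : Measurable ν) : (μ.map g).bind ν = μ.bind fun a => ν (g a) := by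
  rw [Measure.bind, Measure.bind, Measure.map_map hν hg]
  rfl

end Mixtures

section InvariantAffineMeasure

variable [FiniteDimensional ℝ V] [MeasurableSpace V] [BorelSpace V]

theorem AffGr.measurable_lintegral_fibre {φ : AffGr k V → ℝ≥0∞} (hφ : Measurable φ) :
    Measurable fun ξ : Gr k V => ∫⁻ τ, φ τ ∂AffGr.fibre ξ :=
  (Measure.measurable_lintegral hφ).comp AffGr.measurable_fibre

theorem AffGr.lintegral_measure {φ : AffGr k V → ℝ≥0∞} (hφ : Measurable φ) :
    ∫⁻ τ, φ τ ∂AffGr.measure k V = ∫⁻ ξ, ∫⁻ τ, φ τ ∂AffGr.fibre ξ ∂Gr.measure k V :=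
  Measure.lintegral_bind AffGr.measurable_fibre.aemeasurable hφ.aemeasurable

theorem AffGr.map_measure [FiniteDimensional ℝ V'] [MeasurableSpace V']
    [BorelSpace V'] (e : V ≃ₗᵢ[ℝ] V') :
    (AffGr.measure k V).map (AffGr.emb e.toLinearIsometry 0) = AffGr.measure k V' := by
  have hm := (AffGr.continuous_emb (k := k) e.toLinearIsometry (Submodule.zero_mem _)).measurable
  rw [AffGr.measure, AffGr.measure, map_bind AffGr.measurable_fibre hm, ← Gr.map_measure e,
    bind_map (Gr.continuous_map _).measurable AffGr.measurable_fibre]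
  simp only [AffGr.map_emb_fibre]

theorem AffGr.measure_eq_map (W : Gr k V) :
    AffGr.measure k V =
      ((orthHaar V).prod (AffGr.fibre W)).map fun p => AffGr.rotate p.1 p.2 := by
  have hm := (AffGr.continuous_rotate_uncurry (V := V) (k := k)).measurable
  refine Measure.ext_of_lintegral _ fun φ hφ => ?_
  have hφm : Measurable fun p : Orth V × AffGr k V => φ (AffGr.rotate p.1 p.2) := hφ.comp hm
  rw [lintegral_map hφ hm, AffGr.lintegral_measure hφ, lintegral_prod _ hφm.aemeasurable,
    Gr.lintegral_measure W (AffGr.measurable_lintegral_fibre hφ)]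
  refine lintegral_congr fun U => ?_
  rw [← AffGr.map_rotate_fibre, lintegral_map hφ (AffGr.continuous_rotate U).measurable]

instance : SFinite (AffGr.measure k V) := by
  rcases isEmpty_or_nonempty (Gr k V) with hV | ⟨⟨W⟩⟩
  · have : IsEmpty (AffGr k V) := ⟨fun τ => hV.elim τ.dir⟩
    rw [Measure.eq_zero_of_isEmpty (AffGr.measure k V)]
    infer_instance
  · rw [AffGr.measure_eq_map W]
    infer_instance

theorem AffGr.lintegral_measure_eq_rotate (W : Gr k V) {φ : AffGr k V → ℝ≥0∞}
    (hφ : Measurable φ) : ∫⁻ τ, φ τ ∂AffGr.measure k V =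
      ∫⁻ U, ∫⁻ τ, φ (AffGr.rotate U τ) ∂AffGr.fibre W ∂orthHaar V := by
  have hm := (AffGr.continuous_rotate_uncurry (V := V) (k := k)).measurable
  have hφm : Measurable fun p : Orth V × AffGr k V => φ (AffGr.rotate p.1 p.2) := hφ.comp hm
  rw [AffGr.measure_eq_map W, lintegral_map hφ hm, lintegral_prod _ hφm.aemeasurable]

end InvariantAffineMeasure

/-! ### Planes contained in a plane -/

section Subplanes

/-- The isometry of a subspace onto its image under an isometry. -/
def Gr.subEquiv (L : V →ₗᵢ[ℝ] V') (η : Gr m V) : η.sub ≃ₗᵢ[ℝ] (η.map L).sub :=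
  LinearIsometryEquiv.ofSurjective
    { toLinearMap := L.toLinearMap.submoduleMap η.sub
      norm_map' := fun x => L.norm_map x }
    (L.toLinearMap.submoduleMap_surjective η.sub)

theorem Gr.incl_map_subEquiv (L : V →ₗᵢ[ℝ] V') (η : Gr m V) (ξ : Gr k η.sub) :
    (ξ.map (Gr.subEquiv L η).toLinearIsometry).incl = ξ.incl.map L := by
  change (ξ.map _).map (η.map L).sub.subtypeₗᵢ = (ξ.map η.sub.subtypeₗᵢ).map L
  rw [Gr.map_map, Gr.map_map]
  rfl

variable [FiniteDimensional ℝ V]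

theorem Gr.continuous_incl {h : Submodule ℝ V} : Continuous (Gr.incl : Gr k h → Gr k V) :=
  Gr.continuous_map h.subtypeₗᵢ

variable [FiniteDimensional ℝ V']

theorem AffGr.emb_emb_subEquiv (L : V →ₗᵢ[ℝ] V') (η : Gr m V) (u : V) (v : V')
    (τ : AffGr k η.sub) :
    AffGr.emb (η.map L).sub.subtypeₗᵢ (L u + v)
        (AffGr.emb (Gr.subEquiv L η).toLinearIsometry 0 τ) =
      AffGr.emb L v (AffGr.emb η.sub.subtypeₗᵢ u τ) := by
  rw [AffGr.emb_emb, AffGr.emb_emb, map_zero, zero_add]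
  rfl

end Subplanes

section DirectionsInSubspace

variable [FiniteDimensional ℝ V]

/-- The invariant probability measure on the `k`-dimensional subspaces of `η`, as a measure on the
subspaces of the ambient space. -/
def Gr.inclMeasure (k : ℕ) (η : Gr m V) : Measure (Gr k V) :=
  (Gr.measure k η.sub).map Gr.incl

theorem Gr.inclMeasure_rotate (U : Orth V) (η : Gr m V) :
    Gr.inclMeasure k (Gr.rotate U η) = (Gr.inclMeasure k η).map (Gr.rotate U) := by
  let L := (Unitary.linearIsometryEquiv U).toLinearIsometry
  change Gr.inclMeasure k (η.map L) = _
  rw [Gr.inclMeasure, Gr.inclMeasure, ← Gr.map_measure (Gr.subEquiv L η),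
    Measure.map_map Gr.continuous_incl.measurable (Gr.continuous_map _).measurable,
    Measure.map_map (Gr.continuous_rotate' U).measurable Gr.continuous_incl.measurable]
  congr 1
  funext ξ
  exact Gr.incl_map_subEquiv L η ξ

theorem Gr.measurable_inclMeasure : Measurable (Gr.inclMeasure (m := m) (V := V) k) := by
  rcases isEmpty_or_nonempty (Gr m V) with h | ⟨⟨W⟩⟩
  · exact measurable_of_empty _
  refine Gr.measurable_of_comp_rotate W (Measure.measurable_of_measurable_coe _ fun s hs => ?_)
  have hm : Measurable fun p : Orth V × Gr k W.sub => Gr.rotate p.1 p.2.incl :=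
    (Gr.continuous_rotate_uncurry.comp
      (continuous_fst.prodMk (Gr.continuous_incl.comp continuous_snd))).measurable
  convert measurable_measure_prodMk_left (ν := Gr.measure k W.sub) (hm hs) using 1
  funext U
  rw [Gr.inclMeasure_rotate, Gr.inclMeasure,
    Measure.map_map (Gr.continuous_rotate' U).measurable Gr.continuous_incl.measurable,
    Measure.map_apply ((Gr.continuous_rotate' U).measurable.comp Gr.continuous_incl.measurable) hs]
  rfl

theorem Gr.bind_inclMeasure (hkm : k ≤ m) (hm : m ≤ Module.finrank ℝ V) :
    (Gr.measure m V).bind (Gr.inclMeasure k) = Gr.measure k V := by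
  have := Gr.isProbabilityMeasure hm
  have hprob (η : Gr m V) : IsProbabilityMeasure (Gr.inclMeasure k η) :=
    have := Gr.isProbabilityMeasure (hkm.trans_eq η.finrank_eq.symm)
    Measure.isProbabilityMeasure_map Gr.continuous_incl.measurable.aemeasurable
  have : IsProbabilityMeasure ((Gr.measure m V).bind (Gr.inclMeasure k)) :=
    isProbabilityMeasure_bind Gr.measurable_inclMeasure.aemeasurable (ae_of_all _ hprob)
  refine Gr.eq_measure_of_map_rotate _ fun U => ?_
  rw [map_bind Gr.measurable_inclMeasure (Gr.continuous_rotate' U).measurable]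
  conv_rhs => rw [← Gr.map_rotate_measure U,
    bind_map (Gr.continuous_rotate' U).measurable Gr.measurable_inclMeasure]
  simp only [Gr.inclMeasure_rotate]

variable [MeasurableSpace V] [BorelSpace V]

/-- The measure `dξ du` on the affine `k`-planes `ξ + u` of the ambient space whose direction `ξ` is
contained in `η`. -/
def AffGr.dirMeasure (k : ℕ) (η : Gr m V) : Measure (AffGr k V) :=
  (Gr.inclMeasure k η).bind AffGr.fibre

theorem AffGr.measurable_dirMeasure : Measurable (AffGr.dirMeasure (m := m) (V := V) k) :=
  (Measure.measurable_bind' AffGr.measurable_fibre).comp Gr.measurable_inclMeasure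

theorem AffGr.bind_dirMeasure (hkm : k ≤ m) (hm : m ≤ Module.finrank ℝ V) :
    (Gr.measure m V).bind (AffGr.dirMeasure k) = AffGr.measure k V := by
  rw [AffGr.measure, ← Gr.bind_inclMeasure hkm hm, Measure.bind_bind
    Gr.measurable_inclMeasure.aemeasurable AffGr.measurable_fibre.aemeasurable]
  rfl

theorem AffGr.measurable_fibre_incl {h : Submodule ℝ V} :
    Measurable fun ξ : Gr k h => AffGr.fibre ξ.incl :=
  AffGr.measurable_fibre.comp Gr.continuous_incl.measurable

theorem AffGr.dirMeasure_eq_bind (η : Gr m V) :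
    AffGr.dirMeasure k η = (Gr.measure k η.sub).bind fun ξ => AffGr.fibre ξ.incl :=
  bind_map Gr.continuous_incl.measurable AffGr.measurable_fibre

theorem AffGr.dirMeasure_eq_map (η : Gr m V) :
    AffGr.dirMeasure k η = ((AffGr.measure k η.sub).prod (eucl η.subᗮ)).map
      fun p => AffGr.emb η.sub.subtypeₗᵢ (p.2 : V) p.1 := by
  have hm := (AffGr.continuous_emb_subtype_uncurry (k := k) η.sub).measurable
  refine Measure.ext_of_lintegral _ fun φ hφ => ?_
  have hφm : Measurable fun p : AffGr k η.sub × η.subᗮ =>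
      φ (AffGr.emb η.sub.subtypeₗᵢ (p.2 : V) p.1) := hφ.comp hm
  rw [AffGr.dirMeasure_eq_bind, Measure.lintegral_bind AffGr.measurable_fibre_incl.aemeasurable
    hφ.aemeasurable, lintegral_map hφ hm, lintegral_prod _ hφm.aemeasurable,
    AffGr.lintegral_measure hφm.lintegral_prod_right']
  refine lintegral_congr fun ξ => ?_
  rw [AffGr.fibre_incl, lintegral_map hφ hm, lintegral_prod _ hφm.aemeasurable]

instance (η : Gr m V) : SFinite (AffGr.dirMeasure k η) := by
  rw [AffGr.dirMeasure_eq_map]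
  infer_instance

end DirectionsInSubspace

section SubplaneMeasure

variable [FiniteDimensional ℝ V] [MeasurableSpace V] [BorelSpace V]
variable [FiniteDimensional ℝ V'] [MeasurableSpace V'] [BorelSpace V']

/-- The invariant measure on the affine `k`-planes contained in the affine plane `ζ`, which is
identified with its direction by taking its foot point as the origin. -/
def AffGr.subMeasure (k : ℕ) (ζ : AffGr m V) : Measure (AffGr k V) :=
  (AffGr.measure k ζ.dir.sub).map (AffGr.emb ζ.dir.sub.subtypeₗᵢ ζ.foot)

theorem AffGr.subMeasure_of {η : Gr m V} {u : V} (hu : u ∈ η.subᗮ) :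
    AffGr.subMeasure k (AffGr.of η u) =
      (AffGr.measure k η.sub).map (AffGr.emb η.sub.subtypeₗᵢ u) := by
  have hcongr {η' : Gr m V} {u' : V} (hη : η' = η) (hu' : u' = u) :
      (AffGr.measure k η'.sub).map (AffGr.emb η'.sub.subtypeₗᵢ u') =
        (AffGr.measure k η.sub).map (AffGr.emb η.sub.subtypeₗᵢ u) := by
    subst hη hu'
    rfl
  exact hcongr (AffGr.dir_of η u) (AffGr.foot_of η u hu)

theorem AffGr.subMeasure_emb (L : V →ₗᵢ[ℝ] V') {v : V'} (hv : v ∈ L.rangeᗮ) (ζ : AffGr m V) :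
    AffGr.subMeasure k (AffGr.emb L v ζ) = (AffGr.subMeasure k ζ).map (AffGr.emb L v) := by
  have hfoot := AffGr.map_foot_add_mem_orthogonal L hv ζ
  rw [AffGr.emb, AffGr.subMeasure_of hfoot, AffGr.subMeasure,
    ← AffGr.map_measure (Gr.subEquiv L ζ.dir),
    Measure.map_map (AffGr.continuous_emb_subtype hfoot).measurable
      (AffGr.continuous_emb _ (Submodule.zero_mem _)).measurable,
    Measure.map_map (AffGr.continuous_emb L hv).measurable
      (AffGr.continuous_emb_subtype ζ.foot_mem).measurable]
  congr 1
  funext τ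
  exact AffGr.emb_emb_subEquiv L ζ.dir ζ.foot v τ

theorem AffGr.subMeasure_rotate (U : Orth V) (ζ : AffGr m V) :
    AffGr.subMeasure k (AffGr.rotate U ζ) = (AffGr.subMeasure k ζ).map (AffGr.rotate U) :=
  AffGr.subMeasure_emb _ (Submodule.zero_mem _) ζ

theorem AffGr.measurable_subMeasure : Measurable (AffGr.subMeasure (m := m) (V := V) k) := by
  rcases isEmpty_or_nonempty (Gr m V) with h | ⟨⟨W⟩⟩
  · have : IsEmpty (AffGr m V) := ⟨fun τ => h.elim τ.dir⟩
    exact measurable_of_empty _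
  have hF : Measurable fun p : Orth V × W.subᗮ => AffGr.rotate p.1 (AffGr.of W (p.2 : V)) :=
    (AffGr.continuous_rotate_uncurry.comp (continuous_fst.prodMk
      ((AffGr.isClosedEmbedding_of W).continuous.comp continuous_snd))).measurable
  have hs : Function.Surjective
      fun p : Orth V × W.subᗮ => AffGr.rotate p.1 (AffGr.of W (p.2 : V)) := fun τ => by
    obtain ⟨U, u, h⟩ := AffGr.exists_rotate W τ
    exact ⟨(U, u), h⟩
  rw [← hF.measurable_comp_iff_of_surjective hs]
  refine Measure.measurable_of_measurable_coe _ fun s hs => ?_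
  have hm : Measurable fun p : (Orth V × W.subᗮ) × AffGr k W.sub =>
      AffGr.rotate p.1.1 (AffGr.emb W.sub.subtypeₗᵢ (p.1.2 : V) p.2) :=
    (AffGr.continuous_rotate_uncurry.comp ((continuous_fst.comp continuous_fst).prodMk
      ((AffGr.continuous_emb_subtype_uncurry W.sub).comp
        (continuous_snd.prodMk (continuous_snd.comp continuous_fst))))).measurable
  convert measurable_measure_prodMk_left (ν := AffGr.measure k W.sub) (hm hs) using 1
  funext p
  have hp := (AffGr.continuous_emb_subtype (k := k) p.2.2).measurable
  rw [Function.comp, AffGr.subMeasure_rotate, AffGr.subMeasure_of p.2.2,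
    Measure.map_map (AffGr.continuous_rotate p.1).measurable hp,
    Measure.map_apply ((AffGr.continuous_rotate p.1).measurable.comp hp) hs]
  rfl

theorem AffGr.bind_fibre_subMeasure (η : Gr m V) :
    (AffGr.fibre η).bind (AffGr.subMeasure k) = AffGr.dirMeasure k η := by
  have hm := (AffGr.continuous_emb_subtype_uncurry (k := k) η.sub).measurable
  refine Measure.ext_of_lintegral _ fun φ hφ => ?_
  have hφm : Measurable fun p : AffGr k η.sub × η.subᗮ =>
      φ (AffGr.emb η.sub.subtypeₗᵢ (p.2 : V) p.1) := hφ.comp hm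
  rw [Measure.lintegral_bind AffGr.measurable_subMeasure.aemeasurable hφ.aemeasurable,
    AffGr.lintegral_fibre, AffGr.dirMeasure_eq_map, lintegral_map hφ hm,
    lintegral_prod_symm _ hφm.aemeasurable]
  refine lintegral_congr fun u => ?_
  rw [AffGr.subMeasure_of u.2, lintegral_map hφ (AffGr.continuous_emb_subtype u.2).measurable]

theorem AffGr.bind_subMeasure (hkm : k ≤ m) (hm : m ≤ Module.finrank ℝ V) :
    (AffGr.measure m V).bind (AffGr.subMeasure k) = AffGr.measure k V := by
  rw [← AffGr.bind_dirMeasure hkm hm, AffGr.measure, Measure.bind_bind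
    AffGr.measurable_fibre.aemeasurable AffGr.measurable_subMeasure.aemeasurable]
  simp only [AffGr.bind_fibre_subMeasure]

end SubplaneMeasure

section Polish

variable [FiniteDimensional ℝ V]

instance : PolishSpace (Gr k V) :=
  (Gr.isEmbedding_starProjection.continuous.isClosedEmbedding
    Gr.isEmbedding_starProjection.injective).polishSpace

instance : PolishSpace (AffGr k V) := by
  refine IsClosedEmbedding.polishSpace ⟨AffGr.isEmbedding_dir_foot, ?_⟩
  have hrange : Set.range (fun τ : AffGr k V => (τ.dir, τ.foot)) =
      {p | p.1.sub.starProjection p.2 = 0} := by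
    ext ⟨ξ, u⟩
    simp only [Set.mem_range, Set.mem_ofPred_eq, Submodule.starProjection_apply_eq_zero_iff]
    refine ⟨?_, fun hu => ⟨AffGr.of ξ u, by rw [AffGr.dir_of, AffGr.foot_of _ _ hu]⟩⟩
    rintro ⟨τ, h⟩
    obtain ⟨rfl, rfl⟩ := Prod.mk.inj h
    exact τ.foot_mem
  rw [hrange]
  exact isClosed_eq ((Gr.isEmbedding_starProjection.continuous.comp continuous_fst).clm_apply
    continuous_snd) continuous_const

variable [FiniteDimensional ℝ V']

theorem AffGr.emb_injective (L : V →ₗᵢ[ℝ] V') {v : V'} (hv : v ∈ L.rangeᗮ) :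
    Function.Injective (AffGr.emb (k := k) L v) := by
  intro τ τ' h
  have hdir : (τ.dir.map L).sub = (τ'.dir.map L).sub := by
    simpa only [AffGr.dir_emb] using congrArg (fun σ => σ.dir.sub) h
  have hfoot : L τ.foot = L τ'.foot := by
    simpa only [AffGr.foot_emb L hv, add_left_inj] using congrArg AffGr.foot h
  exact AffGr.isEmbedding_dir_foot.injective
    (Prod.ext (Gr.ext (Submodule.map_injective_of_injective L.injective hdir)) (L.injective hfoot))

theorem AffGr.measurableEmbedding_emb (L : V →ₗᵢ[ℝ] V') {v : V'}
    (hv : v ∈ L.rangeᗮ) :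
    MeasurableEmbedding (AffGr.emb (k := k) L v) :=
  (AffGr.continuous_emb L hv).measurableEmbedding (AffGr.emb_injective L hv)

end Polish

theorem integral_bind_of_integrable {X Y E : Type*} [MeasurableSpace X] [MeasurableSpace Y]
    [NormedAddCommGroup E] [NormedSpace ℝ E] {μ : Measure X} {κ : X → Measure Y}
    (hκ : Measurable κ) {F : Y → E} (hF : Integrable F (μ.bind κ)) :
    (∀ᵐ x ∂μ, Integrable F (κ x)) ∧ Integrable (fun x => ∫ y, F y ∂κ x) μ ∧
      ∫ y, F y ∂(μ.bind κ) = ∫ x, ∫ y, F y ∂κ x ∂μ := by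
  let K : ProbabilityTheory.Kernel X Y := ⟨κ, hκ⟩
  have hF' : Integrable F (μ.bind K) := hF
  rw [Measure.comp_eq_comp_const_apply] at hF'
  refine ⟨hF'.ae_of_comp, hF'.integral_comp, ?_⟩
  change ∫ y, F y ∂(μ.bind K) = _
  rw [Measure.comp_eq_comp_const_apply, ProbabilityTheory.Kernel.integral_comp hF']
  rfl

section Slices

variable {h : Submodule ℝ V}

/-- The orthogonal complement of `ξ` in `h` is `ξᗮ ∩ h`. -/
def Gr.orthogonalInf (ξ : Gr k h) : ξ.subᗮ ≃ₗᵢ[ℝ] ↥(ξ.incl.subᗮ ⊓ h) :=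
  LinearIsometryEquiv.ofSurjective
    { toFun := fun x => ⟨((x : h) : V), Gr.coe_mem_orthogonal_incl x.2, x.1.2⟩
      map_add' := fun _ _ => rfl
      map_smul' := fun _ _ => rfl
      norm_map' := fun _ => rfl }
    fun ⟨y, hy, hyh⟩ => ⟨⟨⟨y, hyh⟩, fun w hw => hy _ ⟨w, hw, rfl⟩⟩, rfl⟩

theorem Gr.measurableEmbedding_orthogonalInf [MeasurableSpace V] [BorelSpace V] (ξ : Gr k h) :
    MeasurableEmbedding (Gr.orthogonalInf ξ) :=
  (Gr.orthogonalInf ξ).toHomeomorph.measurableEmbedding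

variable [FiniteDimensional ℝ V]

theorem AffGr.of_orthogonalInf_add (α : V) (ξ : Gr k h) (u : ξ.subᗮ) :
    AffGr.of ξ.incl ((Gr.orthogonalInf ξ u : V) + α) =
      AffGr.emb h.subtypeₗᵢ α (AffGr.of ξ (u : h)) :=
  (AffGr.emb_of h.subtypeₗᵢ α ξ (u : h)).symm

variable [MeasurableSpace V] [BorelSpace V]

theorem lintegral_slice (φ : AffGr k V → ℝ≥0∞) (α : V) (ξ : Gr k h) :
    ∫⁻ y : ↥(ξ.incl.subᗮ ⊓ h), φ (AffGr.of ξ.incl (y + α)) ∂eucl _ =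
      ∫⁻ τ, φ (AffGr.emb h.subtypeₗᵢ α τ) ∂AffGr.fibre ξ := by
  rw [AffGr.lintegral_fibre, ← map_eucl (Gr.orthogonalInf ξ),
    (Gr.measurableEmbedding_orthogonalInf ξ).lintegral_map]
  simp only [AffGr.of_orthogonalInf_add]

theorem ae_slice_iff {P : AffGr k V → Prop} {α : V} {ξ : Gr k h} :
    (∀ᵐ y : ↥(ξ.incl.subᗮ ⊓ h) ∂eucl _, P (AffGr.of ξ.incl (y + α))) ↔
      ∀ᵐ τ ∂AffGr.fibre ξ, P (AffGr.emb h.subtypeₗᵢ α τ) := by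
  rw [AffGr.fibre, (AffGr.measurableEmbedding_of ξ).ae_map_iff, ← map_eucl (Gr.orthogonalInf ξ),
    (Gr.measurableEmbedding_orthogonalInf ξ).ae_map_iff]
  simp only [AffGr.of_orthogonalInf_add]

theorem sliceConverges_iff {f : AffGr k V → ℂ} {α : V} {ξ : Gr k h} :
    SliceConverges f h α ξ ↔
      Integrable (fun τ => f (AffGr.emb h.subtypeₗᵢ α τ)) (AffGr.fibre ξ) := by
  rw [SliceConverges, AffGr.fibre, (AffGr.measurableEmbedding_of ξ).integrable_map_iff,
    ← map_eucl (Gr.orthogonalInf ξ), (Gr.measurableEmbedding_orthogonalInf ξ).integrable_map_iff]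
  simp only [Function.comp_def, AffGr.of_orthogonalInf_add]

theorem sliceInt_eq (f : AffGr k V → ℂ) (α : V) (ξ : Gr k h) :
    sliceInt f h α ξ = ∫ τ, f (AffGr.emb h.subtypeₗᵢ α τ) ∂AffGr.fibre ξ := by
  rw [sliceInt, AffGr.fibre, (AffGr.measurableEmbedding_of ξ).integral_map,
    ← map_eucl (Gr.orthogonalInf ξ), (Gr.measurableEmbedding_orthogonalInf ξ).integral_map]
  simp only [AffGr.of_orthogonalInf_add]

theorem radonAbs_eq (f : AffGr k V → ℂ) (ζ : AffGr m V) :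
    radonAbs f ζ = ∫⁻ ξ, ∫⁻ τ, ‖f (AffGr.emb ζ.dir.sub.subtypeₗᵢ ζ.foot τ)‖ₑ ∂AffGr.fibre ξ
      ∂Gr.measure k ζ.dir.sub := by
  simp only [radonAbs, ← lintegral_slice fun τ => ‖f τ‖ₑ, add_comm]

theorem radon_eq (f : AffGr k V → ℂ) (ζ : AffGr m V) :
    radon f ζ = ∫ ξ, ∫ τ, f (AffGr.emb ζ.dir.sub.subtypeₗᵢ ζ.foot τ) ∂AffGr.fibre ξ
      ∂Gr.measure k ζ.dir.sub := by
  simp only [radon, ← sliceInt_eq, sliceInt, add_comm]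

end Slices

section RadonTransform

variable [FiniteDimensional ℝ V] [MeasurableSpace V] [BorelSpace V]
variable {f : AffGr k V → ℂ} {ζ : AffGr m V}

theorem integrable_subMeasure_iff : Integrable f (AffGr.subMeasure k ζ) ↔
    Integrable (fun τ => f (AffGr.emb ζ.dir.sub.subtypeₗᵢ ζ.foot τ)) (AffGr.measure k ζ.dir.sub) :=
  (AffGr.measurableEmbedding_emb _ (by simpa using ζ.foot_mem)).integrable_map_iff

theorem radonAbs_lt_top_of_integrable (hf : Integrable f (AffGr.subMeasure k ζ)) :
    radonAbs f ζ < ∞ := by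
  have hf' := integrable_subMeasure_iff.mp hf
  rw [radonAbs_eq, ← Measure.lintegral_bind AffGr.measurable_fibre.aemeasurable hf'.1.enorm]
  exact hf'.2

theorem integrable_subMeasure_of_radonAbs_lt_top (hf : Measurable f) (hfin : radonAbs f ζ < ∞) :
    Integrable f (AffGr.subMeasure k ζ) := by
  have hm : Measurable fun τ => f (AffGr.emb ζ.dir.sub.subtypeₗᵢ ζ.foot τ) :=
    hf.comp (AffGr.continuous_emb_subtype ζ.foot_mem).measurable
  refine integrable_subMeasure_iff.mpr ⟨hm.aestronglyMeasurable, ?_⟩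
  rw [HasFiniteIntegral, AffGr.lintegral_measure hm.enorm]
  exact radonAbs_eq f ζ ▸ hfin

theorem radon_eq_integral_subMeasure (hf : Integrable f (AffGr.subMeasure k ζ)) :
    radon f ζ = ∫ τ, f τ ∂AffGr.subMeasure k ζ := by
  rw [radon_eq, AffGr.subMeasure,
    (AffGr.measurableEmbedding_emb _ (by simpa using ζ.foot_mem)).integral_map]
  exact (integral_bind_of_integrable AffGr.measurable_fibre
    (integrable_subMeasure_iff.mp hf)).2.2.symm

variable {h : Submodule ℝ V} {α : V}

theorem radon_emb (hα : α ∈ hᗮ) {σ : AffGr m h}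
    (hf : Integrable (fun τ => f (AffGr.emb h.subtypeₗᵢ α τ)) (AffGr.subMeasure k σ)) :
    radonAbs f (AffGr.emb h.subtypeₗᵢ α σ) < ∞ ∧ radon f (AffGr.emb h.subtypeₗᵢ α σ) =
      ∫ τ, f (AffGr.emb h.subtypeₗᵢ α τ) ∂AffGr.subMeasure k σ := by
  have hα' : α ∈ h.subtypeₗᵢ.rangeᗮ := by rwa [range_subtypeₗᵢ]
  have hemb := AffGr.measurableEmbedding_emb (k := k) h.subtypeₗᵢ hα'
  have hf' : Integrable f (AffGr.subMeasure k (AffGr.emb h.subtypeₗᵢ α σ)) := by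
    rwa [AffGr.subMeasure_emb _ hα', hemb.integrable_map_iff]
  rw [radon_eq_integral_subMeasure hf', AffGr.subMeasure_emb _ hα', hemb.integral_map]
  exact ⟨radonAbs_lt_top_of_integrable hf', rfl⟩

theorem sliceIdentity_of_integrable (hα : α ∈ hᗮ) (η : Gr m h)
    (hf : Integrable (fun τ => f (AffGr.emb h.subtypeₗᵢ α τ)) (AffGr.dirMeasure k η)) :
    SliceIdentity f h α η := by
  have hdir := hf
  rw [AffGr.dirMeasure_eq_bind] at hdir
  obtain ⟨hfibre, hint, hIint⟩ := integral_bind_of_integrable AffGr.measurable_fibre_incl hdir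
  have hsub := hf
  rw [← AffGr.bind_fibre_subMeasure] at hsub
  obtain ⟨hplane, hint', hIint'⟩ := integral_bind_of_integrable AffGr.measurable_subMeasure hsub
  have hradon : (fun σ => ∫ τ, f (AffGr.emb h.subtypeₗᵢ α τ) ∂AffGr.subMeasure k σ) =ᵐ[
      AffGr.fibre η] fun σ => radon f (AffGr.emb h.subtypeₗᵢ α σ) :=
    hplane.mono fun σ hσ => (radon_emb hα hσ).2.symm
  refine ⟨?_, ?_, ?_, ?_, ?_⟩
  · simpa only [sliceConverges_iff] using hfibre
  · simpa only [sliceInt_eq] using hint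
  · exact (ae_slice_iff (P := fun τ => radonAbs f τ < ∞)).mpr (
      hplane.mono fun σ hσ => (radon_emb hα hσ).1)
  · exact sliceConverges_iff.mpr (hint'.congr hradon)
  · calc funk (sliceInt f h α) η
        = ∫ τ, f (AffGr.emb h.subtypeₗᵢ α τ) ∂AffGr.dirMeasure k η := by
          simp only [funk, sliceInt_eq, AffGr.dirMeasure_eq_bind]
          exact hIint.symm
      _ = ∫ σ, radon f (AffGr.emb h.subtypeₗᵢ α σ) ∂AffGr.fibre η := by
          rw [← AffGr.bind_fibre_subMeasure]
          exact hIint'.trans (integral_congr_ae hradon)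
      _ = sliceInt (radon f) h α η := (sliceInt_eq _ _ _).symm

theorem slice_of_integrable_subMeasure {m' : ℕ} (hkm : k ≤ m) (hm : m ≤ m') {ζ : AffGr m' V}
    (hf : Integrable f (AffGr.subMeasure k ζ)) :
    (∀ᵐ ξ ∂Gr.measure k ζ.dir.sub, SliceConverges f ζ.dir.sub ζ.foot ξ) ∧
      Integrable (sliceInt f ζ.dir.sub ζ.foot) (Gr.measure k ζ.dir.sub) ∧
      ∀ᵐ η ∂Gr.measure m ζ.dir.sub, SliceIdentity f ζ.dir.sub ζ.foot η := by
  have hf' := integrable_subMeasure_iff.mp hf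
  obtain ⟨hfibre, hint, -⟩ := integral_bind_of_integrable AffGr.measurable_fibre hf'
  rw [← AffGr.bind_dirMeasure hkm (hm.trans_eq ζ.dir.finrank_eq.symm)] at hf'
  refine ⟨?_, ?_, ?_⟩
  · simpa only [sliceConverges_iff] using hfibre
  · simpa only [← sliceInt_eq] using hint
  · exact (integral_bind_of_integrable AffGr.measurable_dirMeasure hf').1.mono
      fun η hη => sliceIdentity_of_integrable ζ.foot_mem η hη

end RadonTransform

/-! ### Random rotations of a vector -/

section RandomRotations

theorem exists_orth_apply_eq [CompleteSpace V] {u v : V} (h : ‖u‖ = ‖v‖) :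
    ∃ U : Orth V, U.1 u = v ∧ ∀ x, inner ℝ x u = 0 → inner ℝ x v = 0 → U.1 x = x := by
  let e : V ≃ₗᵢ[ℝ] V := (Submodule.span ℝ {u - v})ᗮ.reflection
  refine ⟨Unitary.linearIsometryEquiv.symm e, Submodule.reflection_sub h, fun x hu hv => ?_⟩
  refine Submodule.reflection_mem_subspace_eq_self (K := (Submodule.span ℝ {u - v})ᗮ) ?_
  rw [Submodule.mem_orthogonal_singleton_iff_inner_left, inner_sub_right, hu, hv, sub_zero]

theorem continuous_orth_apply [CompleteSpace V] : Continuous fun p : Orth V × V => p.1.1 p.2 :=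
  (continuous_subtype_val.comp continuous_fst).clm_apply continuous_snd

variable [FiniteDimensional ℝ V]

theorem AffGr.exists_rotate_of_eq_of {ξ : Gr k V} {u v : V} (hu : u ∈ ξ.subᗮ) (hv : v ∈ ξ.subᗮ)
    (h : ‖u‖ = ‖v‖) : ∃ U : Orth V, AffGr.rotate U (AffGr.of ξ u) = AffGr.of ξ v := by
  obtain ⟨U, hUu, hU⟩ := exists_orth_apply_eq h
  have hfix : Gr.rotate U ξ = ξ := Gr.ext (SetLike.coe_injective
    ((Set.image_congr fun x hx => hU x (hu x hx) (hv x hx)).trans (Set.image_id' _)))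
  exact ⟨U, by rw [AffGr.rotate_of, hUu, hfix]⟩

/-- The probability that a random rotation of `u` lies in `A`. -/
def rotProb (A : Set V) (u : V) : ℝ≥0∞ :=
  orthHaar V {U | U.1 u ∈ A}

theorem rotProb_le_one (A : Set V) (u : V) : rotProb A u ≤ 1 :=
  prob_le_one

theorem rotProb_orth_apply (A : Set V) (U : Orth V) (u : V) :
    rotProb A (U.1 u) = rotProb A u :=
  measure_preimage_mul_right (orthHaar V) U {U' | U'.1 u ∈ A}

theorem rotProb_anti {A : Set V} (hA : StarConvex ℝ 0 A) {u v : V} (h : ‖v‖ ≤ ‖u‖) :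
    rotProb A u ≤ rotProb A v := by
  rcases eq_or_ne u 0 with rfl | hu
  · rw [norm_zero, norm_le_zero_iff] at h
    rw [h]
  set s := ‖v‖ / ‖u‖
  have hs : 0 ≤ s := by positivity
  obtain ⟨U, hU, -⟩ := exists_orth_apply_eq (u := s • u) (v := v) (by
    rw [norm_smul, Real.norm_of_nonneg hs, div_mul_cancel₀ _ (norm_ne_zero_iff.mpr hu)])
  calc rotProb A u ≤ rotProb A (s • u) := measure_mono fun U' hU' => by
        rw [Set.mem_ofPred_eq, map_smul]
        exact hA.smul_mem hU' hs (div_le_one_of_le₀ h (norm_nonneg u))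
    _ = rotProb A v := by rw [← hU, rotProb_orth_apply]

variable [MeasurableSpace V] [BorelSpace V]

theorem measurable_rotProb {A : Set V} (hA : MeasurableSet A) : Measurable (rotProb A) :=
  measurable_measure_prodMk_right (continuous_orth_apply.measurable hA)

theorem setLIntegral_eq_lintegral_rotProb_mul {ν : Measure V} [SFinite ν]
    (hν : ∀ U : Orth V, ν.map U.1 = ν) {A : Set V} (hA : MeasurableSet A) {θ : V → ℝ≥0∞}
    (hθ : Measurable θ) (hinv : ∀ (U : Orth V) (u : V), θ (U.1 u) = θ u) :
    ∫⁻ u in A, θ u ∂ν = ∫⁻ u, rotProb A u * θ u ∂ν := by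
  have hmem : MeasurableSet {p : Orth V × V | p.1.1 p.2 ∈ A} := continuous_orth_apply.measurable hA
  have hfibre (u : V) : MeasurableSet {U : Orth V | U.1 u ∈ A} := measurable_prodMk_right hmem
  calc ∫⁻ u in A, θ u ∂ν = ∫⁻ _ : Orth V, ∫⁻ u, A.indicator θ u ∂ν ∂orthHaar V := by
        simp [lintegral_indicator hA]
    _ = ∫⁻ U : Orth V, ∫⁻ u, A.indicator θ (U.1 u) ∂ν ∂orthHaar V := by
        refine lintegral_congr fun U => ?_
        rw [← lintegral_map (hθ.indicator hA) U.1.continuous.measurable, hν]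
    _ = ∫⁻ u, ∫⁻ U : Orth V, {U : Orth V | U.1 u ∈ A}.indicator (fun _ => θ u) U
          ∂orthHaar V ∂ν := by
        rw [lintegral_lintegral_swap (f := fun U : Orth V => fun u => A.indicator θ (U.1 u))
          ((hθ.indicator hA).comp continuous_orth_apply.measurable).aemeasurable]
        simp only [Set.indicator, hinv, Set.mem_ofPred_eq]
    _ = ∫⁻ u, rotProb A u * θ u ∂ν := by
        simp only [lintegral_indicator_const (hfibre _), mul_comm (θ _), rotProb]

theorem rotProb_mul_measure_closedBall_le {ν : Measure V} [SFinite ν]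
    (hν : ∀ U : Orth V, ν.map U.1 = ν) {A : Set V} (hA : MeasurableSet A)
    (hstar : StarConvex ℝ 0 A) (u : V) :
    rotProb A u * ν (Metric.closedBall 0 ‖u‖) ≤ ν (Metric.closedBall 0 ‖u‖ ∩ A) := by
  have hball : MeasurableSet (Metric.closedBall (0 : V) ‖u‖) :=
    Metric.isClosed_closedBall.measurableSet
  have hinv (U : Orth V) (v : V) :
      (Metric.closedBall (0 : V) ‖u‖).indicator (1 : V → ℝ≥0∞) (U.1 v) =
        (Metric.closedBall (0 : V) ‖u‖).indicator 1 v := by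
    have hU : ‖U.1 v‖ = ‖v‖ := ContinuousLinearMap.norm_map_of_mem_unitary U.2 v
    simp only [Set.indicator, mem_closedBall_zero_iff, hU, Pi.one_apply]
  calc rotProb A u * ν (Metric.closedBall 0 ‖u‖)
      = ∫⁻ _ in Metric.closedBall 0 ‖u‖, rotProb A u ∂ν := by rw [setLIntegral_const]
    _ ≤ ∫⁻ v in Metric.closedBall 0 ‖u‖, rotProb A v ∂ν :=
        setLIntegral_mono (measurable_rotProb hA) fun _ hv =>
          rotProb_anti hstar (mem_closedBall_zero_iff.mp hv)
    _ = ∫⁻ v, rotProb A v * (Metric.closedBall 0 ‖u‖).indicator 1 v ∂ν := by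
        rw [← lintegral_indicator hball]
        refine lintegral_congr fun v => ?_
        by_cases hv : v ∈ Metric.closedBall 0 ‖u‖ <;> simp [hv]
    _ = ν (Metric.closedBall 0 ‖u‖ ∩ A) := by
        rw [← setLIntegral_eq_lintegral_rotProb_mul hν hA (measurable_one.indicator hball) hinv,
          lintegral_indicator_one hball, Measure.restrict_apply hball]

end RandomRotations

/-! ### Rotations into a tube -/

section Tubes

variable [FiniteDimensional ℝ V]

/-- The points of `S` whose distance to the subspace `W` is at most `R`. -/
def tube (W S : Submodule ℝ V) (R : ℝ) : Set S :=
  {u | ‖Wᗮ.starProjection (u : V)‖ ≤ R}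

theorem isClosed_tube (W S : Submodule ℝ V) (R : ℝ) : IsClosed (tube W S R) :=
  isClosed_le (Wᗮ.starProjection.continuous.comp continuous_subtype_val).norm continuous_const

theorem starConvex_tube (W S : Submodule ℝ V) {R : ℝ} (hR : 0 ≤ R) :
    StarConvex ℝ 0 (tube W S R) := by
  have hball := (convex_closedBall (0 : V) R).linear_preimage
    (Wᗮ.starProjection.toLinearMap ∘ₗ S.subtype)
  have hset : tube W S R =
      (Wᗮ.starProjection.toLinearMap ∘ₗ S.subtype) ⁻¹' Metric.closedBall 0 R := by
    ext u
    simp [tube]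
  exact (hset ▸ hball).starConvex (by simpa [tube] using hR)

theorem Gr.finrank_orthogonal (ξ : Gr k V) :
    Module.finrank ℝ ξ.subᗮ = Module.finrank ℝ V - k := by
  rw [← ξ.sub.finrank_add_finrank_orthogonal, ξ.finrank_eq, Nat.add_sub_cancel_left]

variable [MeasurableSpace V] [BorelSpace V]

theorem map_repr_eucl (W : Submodule ℝ V) :
    (eucl W).map (stdOrthonormalBasis ℝ W).repr = volume := by
  let _ : MeasureSpace W := measureSpaceOfInnerProductSpace
  exact (stdOrthonormalBasis ℝ W).repr.measurePreserving.map_eq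

theorem lintegral_eucl_comp_norm {W : Submodule ℝ V} {N : ℕ} (hN : Module.finrank ℝ W = N)
    (ψ : ℝ → ℝ≥0∞) :
    ∫⁻ u, ψ ‖u‖ ∂eucl W = ∫⁻ x : EuclideanSpace ℝ (Fin N), ψ ‖x‖ := by
  subst hN
  let e := (stdOrthonormalBasis ℝ W).repr
  have he : MeasurableEmbedding e := e.toHomeomorph.measurableEmbedding
  rw [← map_repr_eucl W, he.lintegral_map]
  simp only [e.norm_map]

/-- The volume of the unit ball of `N`-dimensional Euclidean space. -/
def unitBallVolume (N : ℕ) : ℝ≥0∞ :=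
  volume (Metric.closedBall (0 : EuclideanSpace ℝ (Fin N)) 1)

theorem unitBallVolume_ne_zero (N : ℕ) : unitBallVolume N ≠ 0 :=
  (Metric.measure_closedBall_pos _ _ one_pos).ne'

theorem unitBallVolume_ne_top (N : ℕ) : unitBallVolume N ≠ ∞ :=
  measure_closedBall_lt_top.ne

theorem eucl_closedBall {W : Submodule ℝ V} {N : ℕ} (hN : Module.finrank ℝ W = N) {r : ℝ}
    (hr : 0 ≤ r) :
    eucl W (Metric.closedBall 0 r) = ENNReal.ofReal (r ^ N) * unitBallVolume N := by
  subst hN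
  let e := (stdOrthonormalBasis ℝ W).repr
  rw [Measure.addHaar_closedBall' _ _ hr, unitBallVolume, ← map_repr_eucl W,
    Measure.map_apply e.continuous.measurable Metric.isClosed_closedBall.measurableSet,
    e.preimage_closedBall, map_zero]

theorem Gr.eucl_closedBall_inter_tube_le (W : Gr m V) (ξ : Gr k W.sub) (r R : ℝ) :
    eucl ξ.incl.subᗮ (Metric.closedBall 0 r ∩ tube W.sub ξ.incl.subᗮ R) ≤
      eucl ξ.subᗮ (Metric.closedBall 0 r) * eucl W.subᗮ (Metric.closedBall 0 R) := by
  have hsum : Continuous fun p : ξ.subᗮ × W.subᗮ => Gr.orthogonalSum W.sub ξ (WithLp.toLp 2 p) :=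
    (Gr.orthogonalSum W.sub ξ).continuous.comp (WithLp.prod_continuous_toLp 2 _ _)
  have hmeas : MeasurableSet (Metric.closedBall 0 r ∩ tube W.sub ξ.incl.subᗮ R) :=
    (Metric.isClosed_closedBall.inter (isClosed_tube _ _ _)).measurableSet
  rw [← map_eucl_prod (Gr.orthogonalSum W.sub ξ), Measure.map_apply hsum.measurable hmeas,
    ← Measure.prod_prod]
  refine measure_mono fun p hp => ⟨?_, ?_⟩
  · rw [mem_closedBall_zero_iff]
    refine (WithLp.norm_fst_le _ (WithLp.toLp 2 p)).trans ?_
    rw [← (Gr.orthogonalSum W.sub ξ).norm_map]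
    exact mem_closedBall_zero_iff.mp hp.1
  · have hproj : W.subᗮ.starProjection (((p.1 : W.sub) : V) + (p.2 : V)) = p.2 := by
      rw [map_add, Submodule.starProjection_orthogonal_apply_eq_zero p.1.1.2, zero_add,
        Submodule.starProjection_eq_self_iff.mpr p.2.2]
    rw [mem_closedBall_zero_iff, Submodule.coe_norm, ← hproj]
    exact hp.2

theorem Gr.rotProb_tube_mul_le (W : Gr m V) (hkm : k ≤ m) {R : ℝ} (hR : 0 ≤ R) (ξ : Gr k W.sub)
    {u : ξ.incl.subᗮ} (hu : u ≠ 0) :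
    rotProb (tube W.sub _ R) u * ENNReal.ofReal (‖u‖ ^ (Module.finrank ℝ V - m)) ≤
      unitBallVolume (m - k) * (ENNReal.ofReal (R ^ (Module.finrank ℝ V - m)) *
        unitBallVolume (Module.finrank ℝ V - m)) / unitBallVolume (Module.finrank ℝ V - k) := by
  set d := Module.finrank ℝ V - m
  set N := Module.finrank ℝ V - k
  have hN : N = m - k + d := by
    have := W.le_finrank
    omega
  have hdim : Module.finrank ℝ ξ.subᗮ = m - k := by rw [ξ.finrank_orthogonal, W.finrank_eq]
  have hinv (U : Orth ξ.incl.subᗮ) : (eucl ξ.incl.subᗮ).map U.1 = eucl ξ.incl.subᗮ :=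
    map_eucl (Unitary.linearIsometryEquiv U)
  have hpos : 0 < ENNReal.ofReal (‖u‖ ^ (m - k)) :=
    ENNReal.ofReal_pos.mpr (pow_pos (norm_pos_iff.mpr hu) _)
  have hvol := (rotProb_mul_measure_closedBall_le hinv (isClosed_tube W.sub _ R).measurableSet
    (starConvex_tube W.sub _ hR) u).trans (Gr.eucl_closedBall_inter_tube_le W ξ ‖u‖ R)
  rw [eucl_closedBall ξ.incl.finrank_orthogonal (norm_nonneg u),
    eucl_closedBall hdim (norm_nonneg u), eucl_closedBall W.finrank_orthogonal hR] at hvol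
  rw [ENNReal.le_div_iff_mul_le (.inl (unitBallVolume_ne_zero N)) (.inl (unitBallVolume_ne_top N)),
    ← ENNReal.mul_le_mul_iff_right hpos.ne' ENNReal.ofReal_ne_top]
  calc _ = rotProb (tube W.sub _ R) u * (ENNReal.ofReal (‖u‖ ^ N) * unitBallVolume N) := by
        rw [hN, pow_add, ENNReal.ofReal_mul (by positivity)]
        ring
    _ ≤ _ := hvol
    _ = _ := by ring

theorem Gr.exists_rotProb_tube_le (W : Gr m V) (hkm : k ≤ m) {R : ℝ} (hR : 0 ≤ R) :
    ∃ B ≠ ∞, ∀ (ξ : Gr k W.sub) (u : ξ.incl.subᗮ), rotProb (tube W.sub _ R) u ≤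
      B * ENNReal.ofReal ((1 + ‖u‖) ^ (-((Module.finrank ℝ V - m : ℕ) : ℝ))) := by
  set d := Module.finrank ℝ V - m
  set A : ℝ≥0∞ := unitBallVolume (m - k) * (ENNReal.ofReal (R ^ d) * unitBallVolume d) /
    unitBallVolume (Module.finrank ℝ V - k)
  have hA_ne_top : A ≠ ∞ := ENNReal.div_ne_top (ENNReal.mul_ne_top (unitBallVolume_ne_top _)
    (ENNReal.mul_ne_top ENNReal.ofReal_ne_top (unitBallVolume_ne_top _))) (unitBallVolume_ne_zero _)
  refine ⟨ENNReal.ofReal (2 ^ (d - 1)) * (1 + A), ENNReal.mul_ne_top ENNReal.ofReal_ne_top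
    (ENNReal.add_ne_top.mpr ⟨ENNReal.one_ne_top, hA_ne_top⟩), fun ξ u => ?_⟩
  have hpos : 0 < (1 + ‖u‖) ^ d := by positivity
  rw [Real.rpow_neg (by positivity), Real.rpow_natCast, ENNReal.ofReal_inv_of_pos hpos,
    ← div_eq_mul_inv, ENNReal.le_div_iff_mul_le (.inl (ENNReal.ofReal_pos.mpr hpos).ne')
      (.inl ENNReal.ofReal_ne_top)]
  have hpow : (1 + ‖u‖) ^ d ≤ 2 ^ (d - 1) * (1 + ‖u‖ ^ d) := by
    simpa using add_pow_le zero_le_one (norm_nonneg u) d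
  rcases eq_or_ne u 0 with rfl | hu
  · have hone : 1 ≤ ENNReal.ofReal (2 ^ (d - 1)) := by
      simpa using one_le_pow₀ one_le_two
    simpa using (rotProb_le_one _ _).trans (one_le_mul hone le_self_add)
  calc rotProb (tube W.sub _ R) u * ENNReal.ofReal ((1 + ‖u‖) ^ d)
      ≤ rotProb (tube W.sub _ R) u * ENNReal.ofReal (2 ^ (d - 1) * (1 + ‖u‖ ^ d)) := by gcongr
    _ = ENNReal.ofReal (2 ^ (d - 1)) * (rotProb (tube W.sub _ R) u +
          rotProb (tube W.sub _ R) u * ENNReal.ofReal (‖u‖ ^ d)) := by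
        rw [ENNReal.ofReal_mul (by positivity), ENNReal.ofReal_add zero_le_one (by positivity),
          ENNReal.ofReal_one]
        ring
    _ ≤ ENNReal.ofReal (2 ^ (d - 1)) * (1 + A) := by
        gcongr
        · exact rotProb_le_one _ _
        · exact Gr.rotProb_tube_mul_le W hkm hR ξ hu

/-- Young's inequality against the dual exponent of `p`, in which the tube probability is
integrable precisely because `p` is below the critical exponent. -/
theorem Gr.exists_rotProb_tube_mul_le_rpow_add (W : Gr m V) (hkm : k ≤ m) {R p : ℝ} (hR : 0 ≤ R)
    (hp1 : 1 ≤ p) (hp : p * ((m : ℝ) - k) < (Module.finrank ℝ V : ℝ) - k) :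
    ∃ b : ℝ → ℝ≥0∞, Measurable b ∧
      ∫⁻ x : EuclideanSpace ℝ (Fin (Module.finrank ℝ V - k)), b ‖x‖ ≠ ∞ ∧
      ∀ (ξ : Gr k W.sub) (u : ξ.incl.subᗮ) (a : ℝ≥0∞),
        rotProb (tube W.sub _ R) u * a ≤ a ^ p + b ‖u‖ := by
  rcases hp1.eq_or_lt with rfl | hp1
  · refine ⟨0, measurable_zero, by simp, fun ξ u a => ?_⟩
    simpa using mul_le_of_le_one_left' (rotProb_le_one (tube W.sub _ R) u)
  obtain ⟨B, hB, htube⟩ := Gr.exists_rotProb_tube_le (k := k) W hkm hR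
  have hpq : p.HolderConjugate (p / (p - 1)) := Real.HolderConjugate.conjExponent hp1
  set q := p / (p - 1) with hq
  set d := Module.finrank ℝ V - m with hd
  have hdq : ((Module.finrank ℝ V - k : ℕ) : ℝ) < d * q := by
    rw [hq, hd, Nat.cast_sub (hkm.trans W.le_finrank), Nat.cast_sub W.le_finrank, mul_div_assoc',
      lt_div_iff₀ (by linarith)]
    linarith
  refine ⟨fun r => B ^ q * ENNReal.ofReal ((1 + r) ^ (-(d * q))), by fun_prop, ?_,
    fun ξ u a => ?_⟩
  · rw [lintegral_const_mul _ (by fun_prop)]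
    refine ENNReal.mul_ne_top (ENNReal.rpow_ne_top_of_nonneg hpq.symm.nonneg hB) ?_
    exact (integrable_one_add_norm (by simpa using hdq)).lintegral_lt_top.ne
  · calc rotProb (tube W.sub _ R) u * a
        ≤ a * (B * ENNReal.ofReal ((1 + ‖u‖) ^ (-(d : ℝ)))) := by
          rw [mul_comm]
          gcongr
          exact htube ξ u
      _ ≤ a ^ p + (B * ENNReal.ofReal ((1 + ‖u‖) ^ (-(d : ℝ)))) ^ q := by
          refine (ENNReal.young_inequality _ _ hpq).trans ?_
          gcongr <;> refine ENNReal.div_le_of_le_mul (le_mul_of_one_le_right zero_le ?_)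
          · exact ENNReal.one_le_ofReal.mpr hp1.le
          · exact ENNReal.one_le_ofReal.mpr hpq.symm.lt.le
      _ = _ := by
          rw [ENNReal.mul_rpow_of_nonneg _ _ hpq.symm.nonneg,
            ENNReal.ofReal_rpow_of_nonneg (by positivity) hpq.symm.nonneg,
            ← Real.rpow_mul (by positivity), neg_mul]

end Tubes

/-! ### Integrability on almost every plane -/

section LpIntegrability

variable [FiniteDimensional ℝ V]

theorem AffGr.isClosed_setOf_norm_foot_le (R : ℝ) : IsClosed {ζ : AffGr m V | ‖ζ.foot‖ ≤ R} :=
  isClosed_le AffGr.continuous_foot.norm continuous_const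

theorem AffGr.isClosed_setOf_norm_starProjection_foot_le (W : Submodule ℝ V) (R : ℝ) :
    IsClosed {τ : AffGr k V | ‖W.starProjection τ.foot‖ ≤ R} :=
  isClosed_le (W.starProjection.continuous.comp AffGr.continuous_foot).norm continuous_const

theorem AffGr.lintegral_rotate_rotate (φ : AffGr k V → ℝ≥0∞) (U : Orth V)
    (τ : AffGr k V) :
    ∫⁻ U', φ (AffGr.rotate U' (AffGr.rotate U τ)) ∂orthHaar V =
      ∫⁻ U', φ (AffGr.rotate U' τ) ∂orthHaar V := by
  simp only [← AffGr.rotate_mul]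
  exact lintegral_mul_right_eq_self (fun U' : Orth V => φ (AffGr.rotate U' τ)) U

variable [MeasurableSpace V] [BorelSpace V]

theorem AffGr.subMeasure_inter_setOf_norm_starProjection_foot_le (W : Gr m V) (R : ℝ)
    (u : W.subᗮ) {s : Set (AffGr k V)} (hs : MeasurableSet s) :
    AffGr.subMeasure k (AffGr.of W u) (s ∩ {τ | ‖W.subᗮ.starProjection τ.foot‖ ≤ R}) =
      {ζ : AffGr m V | ‖ζ.foot‖ ≤ R}.indicator (fun ζ => AffGr.subMeasure k ζ s)
        (AffGr.of W u) := by
  have hm := (AffGr.continuous_emb_subtype (k := k) u.2).measurable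
  have hproj (τ : AffGr k W.sub) :
      W.subᗮ.starProjection (AffGr.emb W.sub.subtypeₗᵢ (u : V) τ).foot = u := by
    rw [AffGr.foot_emb _ (by simpa only [range_subtypeₗᵢ] using u.2), map_add,
      Submodule.starProjection_eq_self_iff.mpr u.2]
    simp
  have hpre : AffGr.emb W.sub.subtypeₗᵢ (u : V) ⁻¹'
      {τ : AffGr k V | ‖W.subᗮ.starProjection τ.foot‖ ≤ R} = {_τ | ‖(u : V)‖ ≤ R} :=
    Set.ext fun τ => by rw [Set.mem_preimage, Set.mem_ofPred_eq, hproj, Set.mem_ofPred_eq]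
  rw [AffGr.subMeasure_of u.2, Measure.map_apply hm
    (hs.inter (AffGr.isClosed_setOf_norm_starProjection_foot_le _ R).measurableSet),
    Set.preimage_inter, hpre]
  by_cases hu : ‖(u : V)‖ ≤ R
  · rw [Set.indicator_of_mem (by simpa [AffGr.foot_of W _ u.2] using hu),
      AffGr.subMeasure_of u.2, Measure.map_apply hm hs]
    simp [hu]
  · rw [Set.indicator_of_notMem (by simpa [AffGr.foot_of W _ u.2] using hu)]
    simp [hu]

theorem AffGr.bind_restrict_fibre_subMeasure (W : Gr m V) (R : ℝ) :
    ((AffGr.fibre W).restrict {ζ | ‖ζ.foot‖ ≤ R}).bind (AffGr.subMeasure k) =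
      (AffGr.dirMeasure k W).restrict {τ | ‖W.subᗮ.starProjection τ.foot‖ ≤ R} := by
  have hT := (AffGr.isClosed_setOf_norm_starProjection_foot_le (k := k) W.subᗮ R).measurableSet
  have hm := AffGr.measurable_subMeasure (k := k) (m := m) (V := V)
  ext s hs
  rw [Measure.bind_apply hs hm.aemeasurable, Measure.restrict_apply hs,
    ← AffGr.bind_fibre_subMeasure, Measure.bind_apply (hs.inter hT) hm.aemeasurable,
    ← lintegral_indicator (AffGr.isClosed_setOf_norm_foot_le R).measurableSet,
    AffGr.lintegral_fibre, AffGr.lintegral_fibre]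
  simp only [AffGr.subMeasure_inter_setOf_norm_starProjection_foot_le W R _ hs]

theorem AffGr.lintegral_indicator_subMeasure_rotate (W : Gr m V) (R : ℝ) {φ : AffGr k V → ℝ≥0∞}
    (hφ : Measurable φ) (U : Orth V) :
    ∫⁻ ζ, {ζ : AffGr m V | ‖ζ.foot‖ ≤ R}.indicator
        (fun ζ => ∫⁻ τ, φ τ ∂AffGr.subMeasure k ζ) (AffGr.rotate U ζ) ∂AffGr.fibre W =
      ∫⁻ τ in {τ | ‖W.subᗮ.starProjection τ.foot‖ ≤ R}, φ (AffGr.rotate U τ)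
        ∂AffGr.dirMeasure k W := by
  have hU := (AffGr.continuous_rotate (k := k) U).measurable
  have hφU : Measurable fun τ : AffGr k V => φ (AffGr.rotate U τ) := hφ.comp hU
  have hnorm (ζ : AffGr m V) : ‖(AffGr.rotate U ζ).foot‖ = ‖ζ.foot‖ := by
    rw [AffGr.foot_rotate, ContinuousLinearMap.norm_map_of_mem_unitary U.2]
  rw [← AffGr.bind_restrict_fibre_subMeasure, Measure.lintegral_bind
    AffGr.measurable_subMeasure.aemeasurable hφU.aemeasurable,
    ← lintegral_indicator (AffGr.isClosed_setOf_norm_foot_le R).measurableSet]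
  refine lintegral_congr fun ζ => ?_
  simp only [Set.indicator, Set.mem_ofPred_eq, hnorm, AffGr.subMeasure_rotate, lintegral_map hφ hU]

theorem AffGr.setLIntegral_subMeasure_eq_rotate (W : Gr m V) (R : ℝ) {φ : AffGr k V → ℝ≥0∞}
    (hφ : Measurable φ) :
    ∫⁻ ζ in {ζ : AffGr m V | ‖ζ.foot‖ ≤ R}, ∫⁻ τ, φ τ ∂AffGr.subMeasure k ζ ∂AffGr.measure m V =
      ∫⁻ τ in {τ | ‖W.subᗮ.starProjection τ.foot‖ ≤ R}, ∫⁻ U, φ (AffGr.rotate U τ) ∂orthHaar V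
        ∂AffGr.dirMeasure k W := by
  have hA := (AffGr.isClosed_setOf_norm_foot_le (m := m) (V := V) R).measurableSet
  have hrot : Measurable fun x : Orth V × AffGr k V => φ (AffGr.rotate x.1 x.2) :=
    hφ.comp AffGr.continuous_rotate_uncurry.measurable
  have hint : Measurable fun ζ : AffGr m V => ∫⁻ τ, φ τ ∂AffGr.subMeasure k ζ :=
    (Measure.measurable_lintegral hφ).comp AffGr.measurable_subMeasure
  rw [← lintegral_indicator hA, AffGr.lintegral_measure_eq_rotate W (hint.indicator hA),
    lintegral_congr (AffGr.lintegral_indicator_subMeasure_rotate W R hφ)]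
  exact lintegral_lintegral_swap hrot.aemeasurable

theorem AffGr.setLIntegral_fibre_incl (W : Gr m V) (ξ : Gr k W.sub) (R : ℝ)
    {θ : AffGr k V → ℝ≥0∞} (hθ : Measurable θ)
    (hinv : ∀ (U : Orth V) (τ : AffGr k V), θ (AffGr.rotate U τ) = θ τ) :
    ∫⁻ τ in {τ | ‖W.subᗮ.starProjection τ.foot‖ ≤ R}, θ τ ∂AffGr.fibre ξ.incl =
      ∫⁻ u, rotProb (tube W.sub _ R) u * θ (AffGr.of ξ.incl (u : V)) ∂eucl ξ.incl.subᗮ := by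
  have htube := (isClosed_tube W.sub ξ.incl.subᗮ R).measurableSet
  have hT := (AffGr.isClosed_setOf_norm_starProjection_foot_le (k := k) W.subᗮ R).measurableSet
  have hradial (U : Orth ξ.incl.subᗮ) (u : ξ.incl.subᗮ) :
      θ (AffGr.of ξ.incl ((U.1 u : ξ.incl.subᗮ) : V)) = θ (AffGr.of ξ.incl (u : V)) := by
    have hnorm : ‖(u : V)‖ = ‖((U.1 u : ξ.incl.subᗮ) : V)‖ :=
      (ContinuousLinearMap.norm_map_of_mem_unitary U.2 u).symm
    obtain ⟨U', hU'⟩ := AffGr.exists_rotate_of_eq_of u.2 (U.1 u).2 hnorm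
    exact (congrArg θ hU').symm.trans (hinv U' _)
  have hθξ : Measurable fun u : ξ.incl.subᗮ => θ (AffGr.of ξ.incl (u : V)) :=
    hθ.comp (AffGr.isClosedEmbedding_of ξ.incl).continuous.measurable
  rw [← setLIntegral_eq_lintegral_rotProb_mul
    (fun U => map_eucl (Unitary.linearIsometryEquiv U)) htube hθξ hradial,
    ← lintegral_indicator hT, AffGr.lintegral_fibre, ← lintegral_indicator htube]
  refine lintegral_congr fun u => ?_
  simp only [Set.indicator, tube, Set.mem_ofPred_eq, AffGr.foot_of _ _ u.2]
  rfl

theorem AffGr.setLIntegral_fibre_incl_rotate_le (W : Gr m V) (ξ : Gr k W.sub) {R p : ℝ}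
    {b : ℝ → ℝ≥0∞} (hb : ∀ (u : ξ.incl.subᗮ) (a : ℝ≥0∞),
      rotProb (tube W.sub _ R) u * a ≤ a ^ p + b ‖u‖)
    {φ : AffGr k V → ℝ≥0∞} (hφ : Measurable φ) :
    ∫⁻ τ in {τ | ‖W.subᗮ.starProjection τ.foot‖ ≤ R}, ∫⁻ U, φ (AffGr.rotate U τ) ∂orthHaar V
        ∂AffGr.fibre ξ.incl ≤ ∫⁻ τ, φ τ ^ p ∂AffGr.measure k V +
      ∫⁻ x : EuclideanSpace ℝ (Fin (Module.finrank ℝ V - k)), b ‖x‖ := by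
  have hrot : Measurable fun x : Orth V × AffGr k V => φ (AffGr.rotate x.1 x.2) :=
    hφ.comp AffGr.continuous_rotate_uncurry.measurable
  have hφU (u : ξ.incl.subᗮ) :
      Measurable fun U : Orth V => φ (AffGr.rotate U (AffGr.of ξ.incl (u : V))) :=
    hφ.comp (AffGr.continuous_rotate_uncurry.comp (.prodMk_left _)).measurable
  have hrotp : Measurable fun x : Orth V × AffGr k V => φ (AffGr.rotate x.1 x.2) ^ p :=
    hrot.pow_const p
  have hmean : Measurable fun u : ξ.incl.subᗮ =>
      ∫⁻ U, φ (AffGr.rotate U (AffGr.of ξ.incl (u : V))) ^ p ∂orthHaar V :=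
    hrotp.lintegral_prod_left'.comp (AffGr.isClosedEmbedding_of ξ.incl).continuous.measurable
  calc _ = ∫⁻ u, ∫⁻ U, rotProb (tube W.sub _ R) u * φ (AffGr.rotate U (AffGr.of ξ.incl (u : V)))
          ∂orthHaar V ∂eucl ξ.incl.subᗮ := by
        rw [AffGr.setLIntegral_fibre_incl W ξ R hrot.lintegral_prod_left'
          (AffGr.lintegral_rotate_rotate φ)]
        simp only [lintegral_const_mul _ (hφU _)]
    _ ≤ ∫⁻ u, ∫⁻ U, (φ (AffGr.rotate U (AffGr.of ξ.incl (u : V))) ^ p + b ‖u‖)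
          ∂orthHaar V ∂eucl ξ.incl.subᗮ := by
        gcongr
        exact hb _ _
    _ = ∫⁻ u, (∫⁻ U, φ (AffGr.rotate U (AffGr.of ξ.incl (u : V))) ^ p ∂orthHaar V + b ‖u‖)
          ∂eucl ξ.incl.subᗮ := by
        simp [lintegral_add_right _ measurable_const]
    _ = _ := by
        rw [lintegral_add_left hmean, lintegral_eucl_comp_norm ξ.incl.finrank_orthogonal,
          AffGr.lintegral_measure_eq_rotate ξ.incl (hφ.pow_const p),
          ← AffGr.lintegral_fibre ξ.incl (fun τ => ∫⁻ U, φ (AffGr.rotate U τ) ^ p ∂orthHaar V)]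
        exact congrArg (· + _) (lintegral_lintegral_swap hrotp.aemeasurable).symm

theorem AffGr.setLIntegral_subMeasure_lt_top (hkm : k ≤ m) (hm : m ≤ Module.finrank ℝ V)
    {R p : ℝ} (hR : 0 ≤ R) (hp1 : 1 ≤ p) (hp : p * ((m : ℝ) - k) < (Module.finrank ℝ V : ℝ) - k)
    {φ : AffGr k V → ℝ≥0∞} (hφ : Measurable φ) (hfin : ∫⁻ τ, φ τ ^ p ∂AffGr.measure k V < ∞) :
    ∫⁻ ζ in {ζ : AffGr m V | ‖ζ.foot‖ ≤ R}, ∫⁻ τ, φ τ ∂AffGr.subMeasure k ζ ∂AffGr.measure m V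
      < ∞ := by
  obtain ⟨W⟩ := Gr.nonempty_of_le hm
  obtain ⟨b, -, hbfin, hb⟩ := Gr.exists_rotProb_tube_mul_le_rpow_add W hkm hR hp1 hp
  have hT := (AffGr.isClosed_setOf_norm_starProjection_foot_le (k := k) W.subᗮ R).measurableSet
  have hrot : Measurable fun x : Orth V × AffGr k V => φ (AffGr.rotate x.1 x.2) :=
    hφ.comp AffGr.continuous_rotate_uncurry.measurable
  rw [AffGr.setLIntegral_subMeasure_eq_rotate W R hφ, ← lintegral_indicator hT,
    AffGr.dirMeasure_eq_bind, Measure.lintegral_bind AffGr.measurable_fibre_incl.aemeasurable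
      (hrot.lintegral_prod_left'.indicator hT).aemeasurable]
  simp only [lintegral_indicator hT]
  refine (lintegral_mono fun ξ => AffGr.setLIntegral_fibre_incl_rotate_le W ξ (hb ξ) hφ).trans_lt ?_
  rw [lintegral_const]
  exact ENNReal.mul_lt_top (ENNReal.add_lt_top.mpr ⟨hfin, hbfin.lt_top⟩) (measure_lt_top _ _)

theorem AffGr.ae_subMeasure_of_ae (hkm : k ≤ m) (hm : m ≤ Module.finrank ℝ V)
    {P : AffGr k V → Prop} (hP : ∀ᵐ τ ∂AffGr.measure k V, P τ) :
    ∀ᵐ ζ ∂AffGr.measure m V, ∀ᵐ τ ∂AffGr.subMeasure k ζ, P τ := by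
  let K : ProbabilityTheory.Kernel (AffGr m V) (AffGr k V) := ⟨_, AffGr.measurable_subMeasure⟩
  refine Measure.ae_ae_of_ae_comp (κ := K) ?_
  rwa [← AffGr.bind_subMeasure hkm hm] at hP

theorem AffGr.ae_integrable_subMeasure_of_memLp (hkm : k ≤ m) (hm : m ≤ Module.finrank ℝ V) {p : ℝ}
    (hp1 : 1 ≤ p) (hp : p * ((m : ℝ) - k) < (Module.finrank ℝ V : ℝ) - k) {f : AffGr k V → ℂ}
    (hf : MemLp f (ENNReal.ofReal p) (AffGr.measure k V)) :
    ∀ᵐ ζ ∂AffGr.measure m V, Integrable f (AffGr.subMeasure k ζ) := by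
  have hp0 : 0 < p := by linarith
  let g := hf.1.mk f
  have hg : Measurable g := hf.1.stronglyMeasurable_mk.measurable
  have hfg : f =ᵐ[AffGr.measure k V] g := hf.1.ae_eq_mk
  have hfin : ∫⁻ τ, ‖g τ‖ₑ ^ p ∂AffGr.measure k V < ∞ := by
    simpa only [ENNReal.toReal_ofReal hp0.le] using lintegral_rpow_enorm_lt_top_of_eLpNorm_lt_top
      (by simpa using hp0) ENNReal.ofReal_ne_top ((memLp_congr_ae hfg).mp hf).2
  have hballs : ∀ᵐ ζ ∂AffGr.measure m V, ∀ j : ℕ, ‖ζ.foot‖ ≤ j →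
      ∫⁻ τ, ‖g τ‖ₑ ∂AffGr.subMeasure k ζ < ∞ := ae_all_iff.mpr fun j =>
    (ae_restrict_iff' (AffGr.isClosed_setOf_norm_foot_le (j : ℝ)).measurableSet).mp <|
      ae_lt_top ((Measure.measurable_lintegral hg.enorm).comp AffGr.measurable_subMeasure)
        (AffGr.setLIntegral_subMeasure_lt_top hkm hm j.cast_nonneg hp1 hp hg.enorm hfin).ne
  filter_upwards [AffGr.ae_subMeasure_of_ae hkm hm hfg, hballs] with ζ hfgζ hgζ
  obtain ⟨j, hj⟩ := exists_nat_ge ‖ζ.foot‖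
  have hgint : Integrable g (AffGr.subMeasure k ζ) := ⟨hg.aestronglyMeasurable, hgζ j hj⟩
  exact hgint.congr (hfgζ.mono fun _ h => h.symm)

end LpIntegrability

/-! ### Continuous functions with decay at infinity -/

section Decay

theorem AffGr.dist0_le_dist0_emb [FiniteDimensional ℝ V] [FiniteDimensional ℝ V']
    (L : V →ₗᵢ[ℝ] V') {v : V'} (hv : v ∈ L.rangeᗮ) (τ : AffGr k V) :
    τ.dist0 ≤ (AffGr.emb L v τ).dist0 := by
  have horth : inner ℝ (L τ.foot) v = 0 := hv _ ⟨τ.foot, rfl⟩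
  rw [AffGr.dist0_eq, AffGr.dist0_eq, AffGr.foot_emb L hv, ← L.norm_map τ.foot,
    ← sq_le_sq₀ (norm_nonneg _) (norm_nonneg _), sq, sq,
    norm_add_sq_eq_norm_sq_add_norm_sq_real horth]
  exact le_add_of_nonneg_right (mul_self_nonneg _)

theorem MemC.comp_emb [FiniteDimensional ℝ V] [FiniteDimensional ℝ V'] {μ : ℝ} (hμ : 0 ≤ μ)
    {f : AffGr k V' → ℂ} (hf : MemC μ f) (L : V →ₗᵢ[ℝ] V') {v : V'} (hv : v ∈ L.rangeᗮ) :
    MemC μ fun τ => f (AffGr.emb L v τ) := by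
  have hle := AffGr.dist0_le_dist0_emb (k := k) L hv
  have htop : Tendsto (AffGr.emb L v) (comap (AffGr.dist0 (k := k)) atTop)
      (comap AffGr.dist0 atTop) :=
    tendsto_comap_iff.mpr (tendsto_atTop_mono hle tendsto_comap)
  refine ⟨hf.1.comp (AffGr.continuous_emb L hv), (hf.2.comp_tendsto htop).trans ?_⟩
  refine Asymptotics.IsBigO.of_bound' ?_
  filter_upwards [tendsto_comap.eventually (eventually_gt_atTop 0)] with τ hτ
  have hτ' : 0 < (AffGr.emb L v τ).dist0 := hτ.trans_le (hle τ)
  rw [Function.comp, Real.norm_of_nonneg (by positivity), Real.norm_of_nonneg (by positivity)]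
  exact Real.rpow_le_rpow_of_nonpos hτ (hle τ) (neg_nonpos.mpr hμ)

variable [FiniteDimensional ℝ V]

theorem AffGr.isCompact_setOf_norm_foot_le (A : ℝ) : IsCompact {τ : AffGr k V | ‖τ.foot‖ ≤ A} := by
  rcases isEmpty_or_nonempty (Gr k V) with h | ⟨⟨W⟩⟩
  · have : IsEmpty (AffGr k V) := ⟨fun τ => h.elim τ.dir⟩
    exact Set.toFinite _ |>.isCompact
  have hK : IsCompact ((Set.univ : Set (Orth V)) ×ˢ Metric.closedBall (0 : W.subᗮ) A) :=
    isCompact_univ.prod (isCompact_closedBall _ _)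
  refine (hK.image (AffGr.continuous_rotate_uncurry.comp
    (continuous_id.prodMap (AffGr.isClosedEmbedding_of W).continuous))).of_isClosed_subset
    (AffGr.isClosed_setOf_norm_foot_le A) fun τ hτ => ?_
  obtain ⟨U, u, rfl⟩ := AffGr.exists_rotate W τ
  rw [Set.mem_ofPred_eq, AffGr.foot_rotate, ContinuousLinearMap.norm_map_of_mem_unitary U.2,
    AffGr.foot_of _ _ u.2] at hτ
  exact ⟨(U, u), ⟨Set.mem_univ _, mem_closedBall_zero_iff.mpr hτ⟩, rfl⟩

theorem MemC.exists_bound {μ : ℝ} (hμ : 0 ≤ μ) {f : AffGr k V → ℂ} (hf : MemC μ f) :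
    ∃ C : ℝ, ∀ τ : AffGr k V, ‖f τ‖ ≤ C * (1 + ‖τ.foot‖) ^ (-μ) := by
  obtain ⟨c, hc, hbound⟩ := hf.2.exists_pos
  obtain ⟨A, hA⟩ := eventually_atTop.mp (eventually_comap.mp hbound.bound)
  have hcont : Continuous fun τ : AffGr k V => ‖f τ‖ * (1 + ‖τ.foot‖) ^ μ :=
    hf.1.norm.mul ((continuous_const.add AffGr.continuous_foot.norm).rpow_const fun _ => .inr hμ)
  obtain ⟨M, hM⟩ := (AffGr.isCompact_setOf_norm_foot_le (max A 1)).exists_bound_of_continuousOn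
    hcont.continuousOn
  refine ⟨max M (c * 2 ^ μ), fun τ => ?_⟩
  rw [Real.rpow_neg (by positivity), ← div_eq_mul_inv, le_div_iff₀ (by positivity)]
  rcases le_total ‖τ.foot‖ (max A 1) with h | h
  · exact (Real.le_norm_self _).trans ((hM τ h).trans (le_max_left _ _))
  · have hfoot : 1 ≤ ‖τ.foot‖ := (le_max_right _ _).trans h
    have hfτ : ‖f τ‖ ≤ c * ‖τ.foot‖ ^ (-μ) := by
      simpa [τ.dist0_eq, abs_of_nonneg (Real.rpow_nonneg (norm_nonneg τ.foot) _)] using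
        hA ‖τ.foot‖ ((le_max_left _ _).trans h) τ τ.dist0_eq
    calc ‖f τ‖ * (1 + ‖τ.foot‖) ^ μ ≤ c * ‖τ.foot‖ ^ (-μ) * (2 * ‖τ.foot‖) ^ μ := by
          gcongr
          linarith
      _ = c * 2 ^ μ := by
          rw [Real.mul_rpow zero_le_two (norm_nonneg _), Real.rpow_neg (norm_nonneg _)]
          field_simp
      _ ≤ max M (c * 2 ^ μ) := le_max_right _ _

variable [MeasurableSpace V] [BorelSpace V] {μ : ℝ} {F : AffGr k V → ℂ}

theorem MemC.exists_lintegral_fibre_le (hF : MemC μ F)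
    (hμ : ((Module.finrank ℝ V - k : ℕ) : ℝ) < μ) :
    ∃ I ≠ ∞, ∀ ξ : Gr k V, ∫⁻ τ, ‖F τ‖ₑ ∂AffGr.fibre ξ ≤ I := by
  obtain ⟨C, hC⟩ := hF.exists_bound ((Nat.cast_nonneg _).trans hμ.le)
  have hint : Integrable fun x : EuclideanSpace ℝ (Fin (Module.finrank ℝ V - k)) =>
      C * (1 + ‖x‖) ^ (-μ) :=
    (integrable_one_add_norm (by simpa using hμ)).const_mul C
  refine ⟨_, hint.lintegral_lt_top.ne, fun ξ => ?_⟩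
  rw [AffGr.lintegral_fibre, ← lintegral_eucl_comp_norm ξ.finrank_orthogonal
    (fun r => ENNReal.ofReal (C * (1 + r) ^ (-μ)))]
  refine lintegral_mono fun u => ?_
  rw [← ofReal_norm]
  refine ENNReal.ofReal_le_ofReal ((hC _).trans_eq ?_)
  rw [AffGr.foot_of _ _ u.2, Submodule.coe_norm]

theorem MemC.integrable_bind_fibre (hF : MemC μ F) (hμ : ((Module.finrank ℝ V - k : ℕ) : ℝ) < μ)
    (ν : Measure (Gr k V)) [IsFiniteMeasure ν] : Integrable F (ν.bind AffGr.fibre) := by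
  obtain ⟨I, hI, hle⟩ := hF.exists_lintegral_fibre_le hμ
  refine ⟨hF.1.measurable.aestronglyMeasurable, ?_⟩
  rw [HasFiniteIntegral, Measure.lintegral_bind AffGr.measurable_fibre.aemeasurable
    hF.1.measurable.enorm.aemeasurable]
  exact (lintegral_mono hle).trans_lt <| by
    rw [lintegral_const]
    exact ENNReal.mul_lt_top hI.lt_top (measure_lt_top _ _)

theorem MemC.integrable_fibre (hF : MemC μ F) (hμ : ((Module.finrank ℝ V - k : ℕ) : ℝ) < μ)
    (ξ : Gr k V) : Integrable F (AffGr.fibre ξ) := by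
  simpa only [Measure.dirac_bind AffGr.measurable_fibre] using
    hF.integrable_bind_fibre hμ (Measure.dirac ξ)

theorem MemC.continuous_integral_fibre (hF : MemC μ F)
    (hμ : ((Module.finrank ℝ V - k : ℕ) : ℝ) < μ) :
    Continuous fun ξ : Gr k V => ∫ τ, F τ ∂AffGr.fibre ξ := by
  rcases isEmpty_or_nonempty (Gr k V) with h | ⟨⟨W⟩⟩
  · exact continuous_iff_continuousAt.mpr fun ξ => h.elim ξ
  obtain ⟨C, hC⟩ := hF.exists_bound ((Nat.cast_nonneg _).trans hμ.le)
  have hbound : Integrable (fun u : W.subᗮ => C * (1 + ‖u‖) ^ (-μ)) (eucl W.subᗮ) :=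
    (integrable_one_add_norm (by rwa [W.finrank_orthogonal])).const_mul C
  have hof : Continuous fun u : W.subᗮ => AffGr.of W (u : V) :=
    (AffGr.isClosedEmbedding_of W).continuous
  have hrot (U : Orth V) : ∫ τ, F τ ∂AffGr.fibre (Gr.rotate U W) =
      ∫ u : W.subᗮ, F (AffGr.rotate U (AffGr.of W (u : V))) ∂eucl W.subᗮ := by
    rw [← AffGr.map_rotate_fibre, integral_map (AffGr.continuous_rotate U).measurable.aemeasurable
      hF.1.measurable.aestronglyMeasurable]
    exact (AffGr.measurableEmbedding_of W).integral_map _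
  rw [(Gr.isQuotientMap_rotate W).continuous_iff]
  simp only [Function.comp_def, hrot]
  refine continuous_of_dominated (fun U => ?_) (fun U => ae_of_all _ fun u => ?_) hbound
    (ae_of_all _ fun u => ?_)
  · exact (hF.1.comp ((AffGr.continuous_rotate U).comp hof)).measurable.aestronglyMeasurable
  · simpa only [AffGr.foot_rotate, ContinuousLinearMap.norm_map_of_mem_unitary U.2,
      AffGr.foot_of _ _ u.2, Submodule.coe_norm] using hC (AffGr.rotate U (AffGr.of W (u : V)))
  · have hcomp := (hF.1.comp AffGr.continuous_rotate_uncurry).comp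
      (Continuous.prodMk_left (X := Orth V) (AffGr.of W (u : V)))
    exact hcomp

end Decay

section DecayingSlices

variable [FiniteDimensional ℝ V]

instance (η : Gr m V) : IsFiniteMeasure (Gr.inclMeasure k η) := by
  unfold Gr.inclMeasure
  infer_instance

variable [MeasurableSpace V] [BorelSpace V]

theorem slice_of_memC {l : ℕ} (hkm : k ≤ m) {μ : ℝ} (hμ : (m : ℝ) - k < μ) {f : AffGr k V → ℂ}
    (hf : MemC μ f) (ζ : AffGr m V) :
    radonAbs f ζ < ∞ ∧
      (∀ ξ : Gr k ζ.dir.sub, SliceConverges f ζ.dir.sub ζ.foot ξ) ∧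
      Continuous (sliceInt f ζ.dir.sub ζ.foot : Gr k ζ.dir.sub → ℂ) ∧
      Integrable (sliceInt f ζ.dir.sub ζ.foot) (Gr.measure k ζ.dir.sub) ∧
      ∀ η : Gr l ζ.dir.sub, SliceIdentity f ζ.dir.sub ζ.foot η := by
  have hμ' : ((Module.finrank ℝ ζ.dir.sub - k : ℕ) : ℝ) < μ := by
    rwa [ζ.dir.finrank_eq, Nat.cast_sub hkm]
  have hF : MemC μ fun τ => f (AffGr.emb ζ.dir.sub.subtypeₗᵢ ζ.foot τ) :=
    hf.comp_emb ((Nat.cast_nonneg _).trans hμ'.le) _ (by simpa using ζ.foot_mem)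
  have hcont : Continuous (sliceInt f ζ.dir.sub ζ.foot : Gr k ζ.dir.sub → ℂ) := by
    simpa only [← sliceInt_eq] using hF.continuous_integral_fibre hμ'
  exact ⟨radonAbs_lt_top_of_integrable
      (integrable_subMeasure_iff.mpr (hF.integrable_bind_fibre hμ' _)),
    fun ξ => sliceConverges_iff.mpr (hF.integrable_fibre hμ' ξ), hcont,
    hcont.integrable_of_hasCompactSupport (.of_compactSpace _),
    fun η => sliceIdentity_of_integrable ζ.foot_mem η (hF.integrable_bind_fibre hμ' _)⟩

end DecayingSlices

end RadonGrassmann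

end

open RadonGrassmann in
theorem lemma3p4_general {V : Type} [NormedAddCommGroup V] [InnerProductSpace ℝ V]
    [FiniteDimensional ℝ V] [MeasurableSpace V] [BorelSpace V] {k k' m : ℕ}
    (hkk' : k ≤ k') (hk'm : k' ≤ m) :
    (∀ (p : ℝ) (f : AffGr k V → ℂ),
      1 ≤ p → p * ((m : ℝ) - k) < (Module.finrank ℝ V : ℝ) - k →
      MemLp f (ENNReal.ofReal p) (AffGr.measure k V) →
      ∀ᵐ ζ ∂(AffGr.measure m V),
        radonAbs f ζ < ∞ ∧
        (∀ᵐ ξ ∂(Gr.measure k ζ.dir.sub), SliceConverges f ζ.dir.sub ζ.foot ξ) ∧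
        Integrable (sliceInt f ζ.dir.sub ζ.foot) (Gr.measure k ζ.dir.sub) ∧
        ∀ᵐ η ∂(Gr.measure k' ζ.dir.sub), SliceIdentity f ζ.dir.sub ζ.foot η) ∧
    (∀ f : AffGr k V → ℂ, Measurable f → ∀ ζ : AffGr m V, radonAbs f ζ < ∞ →
      (∀ᵐ ξ ∂(Gr.measure k ζ.dir.sub), SliceConverges f ζ.dir.sub ζ.foot ξ) ∧
      Integrable (sliceInt f ζ.dir.sub ζ.foot) (Gr.measure k ζ.dir.sub) ∧
      ∀ᵐ η ∂(Gr.measure k' ζ.dir.sub), SliceIdentity f ζ.dir.sub ζ.foot η) ∧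
    (∀ (μ : ℝ) (f : AffGr k V → ℂ), (m : ℝ) - k < μ → MemC μ f → ∀ ζ : AffGr m V,
      radonAbs f ζ < ∞ ∧
      (∀ ξ : Gr k ζ.dir.sub, SliceConverges f ζ.dir.sub ζ.foot ξ) ∧
      Continuous (sliceInt f ζ.dir.sub ζ.foot : Gr k ζ.dir.sub → ℂ) ∧
      Integrable (sliceInt f ζ.dir.sub ζ.foot) (Gr.measure k ζ.dir.sub) ∧
      ∀ η : Gr k' ζ.dir.sub, SliceIdentity f ζ.dir.sub ζ.foot η) := by
  have hkm : k ≤ m := hkk'.trans hk'm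
  refine ⟨fun p f hp1 hp hf => ?_, fun f hf ζ hfin => slice_of_integrable_subMeasure hkk' hk'm
    (integrable_subMeasure_of_radonAbs_lt_top hf hfin), fun μ f hμ hf => slice_of_memC hkm hμ hf⟩
  have hm : m ≤ Module.finrank ℝ V := by
    have hkm' : (0 : ℝ) ≤ (m : ℝ) - k := sub_nonneg.mpr (Nat.cast_le.mpr hkm)
    exact_mod_cast (sub_lt_sub_iff_right _).mp
      ((le_mul_of_one_le_left hkm' hp1).trans_lt hp) |>.le
  filter_upwards [AffGr.ae_integrable_subMeasure_of_memLp hkm hm hp1 hp hf] with ζ hζ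
  exact ⟨radonAbs_lt_top_of_integrable hζ, slice_of_integrable_subMeasure hkk' hk'm hζ⟩

open RadonGrassmann in
theorem lemma3p4 (n k k' κ : ℕ) (hk : 0 < k) (hkk' : k < k') (hκ : k ≤ κ) (hn : k' + κ < n) :
    -- (i) the `L^p` case
    (∀ (p : ℝ) (f : AffGr k (EuclideanSpace ℝ (Fin n)) → ℂ),
      1 ≤ p → p < ((n : ℝ) - k) / ((k' : ℝ) - k + κ) →
      MemLp f (ENNReal.ofReal p) (AffGr.measure k (EuclideanSpace ℝ (Fin n))) →
      (∀ᵐ ζ ∂(AffGr.measure (k' + κ) (EuclideanSpace ℝ (Fin n))),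
        radonAbs f ζ < ∞ ∧
        (∀ᵐ ξ ∂(Gr.measure k ζ.dir.sub), SliceConverges f ζ.dir.sub ζ.foot ξ) ∧
        Integrable (sliceInt f ζ.dir.sub ζ.foot) (Gr.measure k ζ.dir.sub) ∧
        ∀ᵐ η ∂(Gr.measure k' ζ.dir.sub), SliceIdentity f ζ.dir.sub ζ.foot η) ∧
      -- for a Borel function `f`, this holds at every plane at which `R̃|f|` is finite
      (Measurable f → ∀ ζ : AffGr (k' + κ) (EuclideanSpace ℝ (Fin n)), radonAbs f ζ < ∞ →
        (∀ᵐ ξ ∂(Gr.measure k ζ.dir.sub), SliceConverges f ζ.dir.sub ζ.foot ξ) ∧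
        Integrable (sliceInt f ζ.dir.sub ζ.foot) (Gr.measure k ζ.dir.sub) ∧
        ∀ᵐ η ∂(Gr.measure k' ζ.dir.sub), SliceIdentity f ζ.dir.sub ζ.foot η)) ∧
    -- (ii) the case of continuous functions
    (∀ (μ : ℝ) (f : AffGr k (EuclideanSpace ℝ (Fin n)) → ℂ),
      (k' : ℝ) - k + κ < μ → MemC μ f →
      ∀ ζ : AffGr (k' + κ) (EuclideanSpace ℝ (Fin n)),
        radonAbs f ζ < ∞ ∧
        (∀ ξ : Gr k ζ.dir.sub, SliceConverges f ζ.dir.sub ζ.foot ξ) ∧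
        Continuous (sliceInt f ζ.dir.sub ζ.foot : Gr k ζ.dir.sub → ℂ) ∧
        Integrable (sliceInt f ζ.dir.sub ζ.foot) (Gr.measure k ζ.dir.sub) ∧
        ∀ η : Gr k' ζ.dir.sub, SliceIdentity f ζ.dir.sub ζ.foot η) := by
  have hdim : (k' : ℝ) - k + κ = ((k' + κ : ℕ) : ℝ) - k := by push_cast; ring
  have hpos : (0 : ℝ) < (k' : ℝ) - k + κ :=
    add_pos_of_pos_of_nonneg (sub_pos.mpr (Nat.cast_lt.mpr hkk')) (Nat.cast_nonneg κ)
  obtain ⟨hLp, hBorel, hdecay⟩ := lemma3p4_general (V := EuclideanSpace ℝ (Fin n)) hkk'.le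
    (Nat.le_add_right k' κ)
  refine ⟨fun p f hp1 hp hf => ⟨hLp p f hp1 ?_ hf, hBorel f⟩, fun μ f hμ => hdecay μ f (hdim ▸ hμ)⟩
  rwa [← hdim, finrank_euclideanSpace_fin, ← lt_div_iff₀ hpos]
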